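/- Let $M\ge 1$ and let $f_1,\dots,f_M$ be probability densities on $\mathbb{R}$ (with respect to Lebesgue measure). Put $f_m(x;\mu,\sigma)=\frac1\sigma f_m\!\left(\frac{x-\mu}{\sigma}\right)$ for $\mu\in\mathbb{R}$, $\sigma>0$; let $$\Theta=\Big\{\theta=(\alpha_m,\mu_m,\sigma_m)_{m=1}^M\in\mathbb{R}^{3M} : \alpha_m\ge 0,\ \sum_{m=1}^M\alpha_m=1,\ \sigma_m>0\Big\},\qquad f(x;\theta)=\sum_{m=1}^M\alpha_m f_m(x;\mu_m,\sigma_m),$$ with the Euclidean distance $\mathrm{dist}$ on $\Theta$. For $K\le M$ let $\mathscr{G}_K$ be the set of all functions $\sum_{m\in\mathscr{K}}\alpha_m f_m(x;\mu_m,\sigma_m)$ with $\theta\in\Theta$, $\mathscr{K}\subset\{1,\dots,M\}$, $|\mathscr{K}|\le K$. Here and below, densities that agree Lebesgue-almost everywhere are identified. For $\theta\in\Theta$ let $\Theta(\theta)=\{\theta'\in\Theta : f(x;\theta')=f(x;\theta)\text{ for almost every }x\}$, and for $U,V\subset\Theta$ let $\mathrm{dist}(U,V)=\inf_{\theta\in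 U}\inf_{\theta'\in V}\mathrm{dist}(\theta,\theta')$. Let $\theta_0\in\Theta$, $f_0=f(\cdot;\theta_0)$ and $\Theta_0=\Theta(\theta_0)$. Assume: 1. There are constants $v_0,v_1>0$ and $\beta>1$ with $f_m(x)\le\min\{v_0,\ v_1|x|^{-\beta}\}$ for all $m$ and all $x$ (at $x=0$ this means $f_m(0)\le v_0$). 2. For each $\theta\in\Theta$ and all sufficiently small $\rho>0$, the function $x\mapsto\sup\{f(x;\theta'):\theta'\in\Theta,\ \mathrm{dist}(\theta',\theta)\le\rho\}$ is measurable. 3. For each compact $\Gamma\subset\Theta$ and each $\theta\in\Gamma$ there is a Lebesgue null set $N$ such that $f(x;\theta^{(j)})\to f(x;\theta)$ for every $x\notin N$ and every sequence $\theta^{(j)}\in\Gamma$ with $\theta^{(j)}\to\theta$. 4. $\int|\log f_0(x)|\,f_0(x)\,dx<\infty$. Suppose $f_0\in\mathscr{G}_M\setminus\mathscr{G}_{M-1}$. Let $c_0>0$, $0<d<1$, $c_n=c_0\exp(-n^d)$ and $\Theta_n=\{\theta\in\Theta:\sigma_m\ge c_n,\ m=1,\dots,M\}$. Let $X_1,X_2,\dots$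 be independent random variables with density $f_0$, and let $\hat\theta_n$ be a maximum likelihood estimator restricted to $\Theta_n$, that is, a maximizer of $\theta\mapsto\prod_{i=1}^n f(X_i;\theta)$ over $\Theta_n$. Then, almost surely, if $\hat\theta_n$ is such a maximizer for all sufficiently large $n$, $$\lim_{n\to\infty}\mathrm{dist}\big(\Theta(\hat\theta_n),\Theta_0\big)=0 .$$ -/

import Mathlib

open MeasureTheory ProbabilityTheory Filter Topology
open scoped ENNReal

namespace LocScaleMixture

/-- Parameter vectors `(α₁, μ₁, σ₁, …, α_M, μ_M, σ_M) ∈ ℝ^{3M}` with the Euclidean distance. -/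
abbrev Param (M : ℕ) : Type := EuclideanSpace ℝ (Fin M × Fin 3)

/-- The mixing weight `α_m`. -/
def weight {M : ℕ} (θ : Param M) (m : Fin M) : ℝ := θ (m, 0)

/-- The location parameter `μ_m`. -/
def loc {M : ℕ} (θ : Param M) (m : Fin M) : ℝ := θ (m, 1)

/-- The scale parameter `σ_m`. -/
def scale {M : ℕ} (θ : Param M) (m : Fin M) : ℝ := θ (m, 2)

/-- The parameter space `Θ`. -/
def paramSpace (M : ℕ) : Set (Param M) :=
  {θ | (∑ m, weight θ m = 1) ∧ (∀ m, 0 ≤ weight θ m) ∧ ∀ m, 0 < scale θ m}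

/-- A probability density on `ℝ` with respect to Lebesgue measure. -/
structure IsDensity (g : ℝ → ℝ) : Prop where
  nonneg : ∀ x, 0 ≤ g x
  integrable : Integrable g
  integral_eq_one : ∫ x, g x = 1

/-- The location-scale density `f(x; μ, σ) = σ⁻¹ f((x - μ) / σ; 0, 1)`. -/
noncomputable def locScale (g : ℝ → ℝ) (μ σ x : ℝ) : ℝ := (1 / σ) * g ((x - μ) / σ)

/-- `f_𝒦(x; θ) = ∑_{k ∈ 𝒦} α_k f_k(x; μ_k, σ_k)`, where `f m` is the standard density
`f_m(·; 0, 1)`. -/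
noncomputable def subMixture {M : ℕ} (f : Fin M → ℝ → ℝ) (K : Finset (Fin M))
    (θ : Param M) (x : ℝ) : ℝ :=
  ∑ k ∈ K, weight θ k * locScale (f k) (loc θ k) (scale θ k) x

/-- The mixture density `f(x; θ)` with all `M` components. -/
noncomputable def mixture {M : ℕ} (f : Fin M → ℝ → ℝ) (θ : Param M) (x : ℝ) : ℝ :=
  subMixture f Finset.univ θ x

/-- `𝒢_K`: the subprobability densities with at most `K` components. As usual for densities,
functions that agree Lebesgue almost everywhere are identified. -/
def mixtureClass {M : ℕ} (f : Fin M → ℝ → ℝ) (K : ℕ) : Set (ℝ → ℝ) :=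
  {g | ∃ S : Finset (Fin M), S.card ≤ K ∧ ∃ θ ∈ paramSpace M, g =ᵐ[volume] subMixture f S θ}

/-- `Θ(θ)`: the parameters in `Θ` that give the same density as `θ`
(up to Lebesgue null sets, i.e. the same distribution). -/
def equivParams {M : ℕ} (f : Fin M → ℝ → ℝ) (θ : Param M) : Set (Param M) :=
  {θ' | θ' ∈ paramSpace M ∧ mixture f θ' =ᵐ[volume] mixture f θ}

/-- `dist(U, V) = inf_{θ ∈ U} inf_{θ' ∈ V} dist(θ, θ')`, with value `∞` if a set is empty. -/
noncomputable def setDist {M : ℕ} (U V : Set (Param M)) : ℝ≥0∞ :=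
  ⨅ θ ∈ U, ⨅ θ' ∈ V, edist θ θ'

/-- Boundedness and tail condition: `f_m(x; 0, 1) ≤ min {v₀, v₁ |x|^{-β}}` for some `v₀, v₁ > 0`
and `β > 1`. At `x = 0` the second bound is `+∞`, hence void. -/
def TailBound {M : ℕ} (f : Fin M → ℝ → ℝ) : Prop :=
  ∃ v₀ v₁ β : ℝ, 0 < v₀ ∧ 0 < v₁ ∧ 1 < β ∧
    ∀ m x, f m x ≤ v₀ ∧ (x ≠ 0 → f m x ≤ v₁ * |x| ^ (-β))

/-- `f(x; θ, ρ) = sup {f(x; θ') : θ' ∈ Θ, dist(θ', θ) ≤ ρ}`. Under `TailBound` the supremum is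
finite as soon as `ρ < min_m σ_m`, so only for such `ρ` is the value used. -/
noncomputable def ballSup {M : ℕ} (f : Fin M → ℝ → ℝ) (θ : Param M) (ρ x : ℝ) : ℝ :=
  ⨆ θ' : {θ' : Param M // θ' ∈ paramSpace M ∧ dist θ' θ ≤ ρ}, mixture f θ'.1 x

/-- For each `θ` and all sufficiently small `ρ > 0`, `f(·; θ, ρ)` is (Lebesgue) measurable. -/
def SupMeasurable {M : ℕ} (f : Fin M → ℝ → ℝ) : Prop :=
  ∀ θ ∈ paramSpace M, ∀ᶠ ρ in 𝓝[>] (0 : ℝ), AEMeasurable (ballSup f θ ρ) volume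

/-- Continuity in the parameter on compact sets, outside a null set of `x` that may depend on the
limit `θ` but not on the sequence that converges to it. -/
def ParamContinuous {M : ℕ} (f : Fin M → ℝ → ℝ) : Prop :=
  ∀ Γ : Set (Param M), IsCompact Γ → Γ ⊆ paramSpace M → ∀ θ ∈ Γ,
    ∃ N : Set ℝ, volume N = 0 ∧
      ∀ u : ℕ → Param M, (∀ j, u j ∈ Γ) → Tendsto u atTop (𝓝 θ) →
        ∀ x, x ∉ N → Tendsto (fun j => mixture f (u j) x) atTop (𝓝 (mixture f θ x))

/-- `∫ |log f(x; θ₀)| f(x; θ₀) dx < ∞`. -/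
def LogIntegrable {M : ℕ} (f : Fin M → ℝ → ℝ) (θ₀ : Param M) : Prop :=
  Integrable (fun x => |Real.log (mixture f θ₀ x)| * mixture f θ₀ x) volume

/-- The distribution on `ℝ` with density `f(·; θ)`. -/
noncomputable def mixtureLaw {M : ℕ} (f : Fin M → ℝ → ℝ) (θ : Param M) : Measure ℝ :=
  volume.withDensity (fun x => ENNReal.ofReal (mixture f θ x))

/-- `Θ_n = {θ ∈ Θ : σ_m ≥ c_n for all m}` with `c_n = c₀ exp(-n^d)`. -/
def restrictedSpace (M : ℕ) (c₀ d : ℝ) (n : ℕ) : Set (Param M) :=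
  {θ | θ ∈ paramSpace M ∧ ∀ m, c₀ * Real.exp (-((n : ℝ) ^ d)) ≤ scale θ m}

/-- The likelihood of `θ` given the first `n` terms of the sequence of observations `x`. -/
noncomputable def likelihood {M : ℕ} (f : Fin M → ℝ → ℝ) (x : ℕ → ℝ) (n : ℕ) (θ : Param M) : ℝ :=
  ∏ i ∈ Finset.range n, mixture f θ (x i)

/-- `θ` maximizes the likelihood of the first `n` observations over the set `S`. -/
def IsMLE {M : ℕ} (f : Fin M → ℝ → ℝ) (S : Set (Param M)) (x : ℕ → ℝ) (n : ℕ) (θ : Param M) :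
    Prop :=
  θ ∈ S ∧ ∀ θ' ∈ S, likelihood f x n θ' ≤ likelihood f x n θ

end LocScaleMixture

/-!
By Gibbs' inequality, `E log f(X; θ)` is uniquely maximized by the mixtures that are almost
everywhere equal to `f(·; θ₀)`, and by the law of large numbers the likelihood singles these out on
every compact subset of `Θ`. Outside the compact subsets, some components have a scale tending to
`0` or `∞`, or a location tending to `±∞`. A component with scale `σ ≥ c_n` is relevant only on an
interval whose length is a power of `σ`, where it raises the log-likelihood of an observation by
at most `log (1 + a / σ)`. Almost surely every interval of length `ℓ` contains `O(n ℓ + log n)` of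
the first `n` observations, and far away there are few of them, so the gain per observation tends
to `0` as soon as `log n * log c_n / n → 0`. In the limit of a subsequence of the estimators the
degenerating components may thus be replaced by components with the same weights, location `0` and
an arbitrary scale `N`, and each of the resulting mixtures must be `f(·; θ₀)`. For `N → ∞` these
components disappear, and `f(·; θ₀)` would have fewer than `M` components unless nothing
degenerates.
-/

namespace LocScaleMixture

/-! ### Elementary inequalities -/

lemma log_one_add_div_nonneg {a σ : ℝ} (ha : 0 ≤ a) (hσ : 0 ≤ σ) : 0 ≤ Real.log (1 + a / σ) :=
  Real.log_nonneg (le_add_of_nonneg_right (div_nonneg ha hσ))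

lemma log_one_add_div_le {a σ : ℝ} (ha : 0 ≤ a) (hσ : 0 < σ) :
    Real.log (1 + a / σ) ≤ Real.log (1 + a) + |Real.log σ| := by
  have hinv : σ⁻¹ ≤ Real.exp |Real.log σ| := by
    rw [← Real.exp_log (inv_pos.2 hσ), Real.log_inv]
    exact Real.exp_le_exp.2 (neg_le_abs _)
  have hone : 1 ≤ Real.exp |Real.log σ| := Real.one_le_exp (abs_nonneg _)
  calc Real.log (1 + a / σ) ≤ Real.log ((1 + a) * Real.exp |Real.log σ|) := by
        refine Real.log_le_log (by positivity) ?_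
        rw [add_mul, one_mul, div_eq_mul_inv]
        gcongr
    _ = Real.log (1 + a) + |Real.log σ| := by
        rw [Real.log_mul (by positivity) (Real.exp_ne_zero _), Real.log_exp]

lemma tendsto_rpow_mul_log_one_add_div {γ a : ℝ} (hγ : 0 < γ) (ha : 0 ≤ a) :
    Tendsto (fun σ : ℝ => σ ^ γ * Real.log (1 + a / σ)) (𝓝[>] 0) (𝓝 0) := by
  have hpow : Tendsto (fun σ : ℝ => σ ^ γ) (𝓝[>] 0) (𝓝 0) := by
    simpa [Real.zero_rpow hγ.ne'] using
      (Real.continuousAt_rpow_const 0 γ (.inr hγ.le)).tendsto.mono_left nhdsWithin_le_nhds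
  have hlim : Tendsto (fun σ : ℝ => σ ^ γ * Real.log (1 + a) + |Real.log σ * σ ^ γ|)
      (𝓝[>] 0) (𝓝 0) := by
    simpa using (hpow.mul_const _).add (tendsto_log_mul_rpow_nhdsGT_zero hγ).abs
  refine squeeze_zero' ?_ ?_ hlim
  all_goals filter_upwards [self_mem_nhdsWithin] with σ (hσ : 0 < σ)
  · exact mul_nonneg (by positivity) (log_one_add_div_nonneg ha hσ.le)
  · rw [abs_mul, abs_of_nonneg (Real.rpow_nonneg hσ.le γ), mul_comm |_|, ← mul_add]
    gcongr
    exact log_one_add_div_le ha hσ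

lemma tendsto_log_div_natCast : Tendsto (fun n : ℕ => Real.log n / (n : ℝ)) atTop (𝓝 0) :=
  Real.isLittleO_log_id_atTop.tendsto_div_nhds_zero.comp tendsto_natCast_atTop_atTop

lemma tendsto_log_div_mul_log_const_mul_exp_neg_rpow {c d : ℝ} (hc : 0 < c) (hd : d < 1) :
    Tendsto (fun n : ℕ => Real.log n / n * Real.log (c * Real.exp (-((n : ℝ) ^ d)))) atTop
      (𝓝 0) := by
  have hpow : Tendsto (fun n : ℕ => Real.log n / (n : ℝ) ^ (1 - d)) atTop (𝓝 0) :=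
    (isLittleO_log_rpow_atTop (sub_pos.2 hd)).tendsto_div_nhds_zero.comp
      tendsto_natCast_atTop_atTop
  have hlim := (tendsto_log_div_natCast.mul_const (Real.log c)).sub hpow
  rw [zero_mul, sub_zero] at hlim
  refine hlim.congr' ?_
  filter_upwards [eventually_gt_atTop 0] with n hn
  have hn' : (0 : ℝ) < n := by exact_mod_cast hn
  rw [Real.log_mul hc.ne' (Real.exp_ne_zero _), Real.log_exp, Real.rpow_sub hn', Real.rpow_one]
  field_simp
  ring

lemma log_add_le {A τ b : ℝ} (hτ : 0 < τ) (hA : τ ≤ A) (hb : 0 ≤ b) :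
    Real.log (A + b) ≤ Real.log A + Real.log (1 + b / τ) := by
  have hA0 : 0 < A := hτ.trans_le hA
  rw [← Real.log_mul hA0.ne' (by positivity)]
  refine Real.log_le_log (by positivity) ?_
  rw [mul_one_add, mul_div_left_comm]
  gcongr
  exact le_mul_of_one_le_right hb ((one_le_div hτ).2 hA)

lemma log_add_sum_le {ι : Type*} (S : Finset ι) {A τ : ℝ} (hτ : 0 < τ) (hA : τ ≤ A) {b : ι → ℝ}
    (hb : ∀ i ∈ S, 0 ≤ b i) :
    Real.log (A + ∑ i ∈ S, b i) ≤ Real.log A + ∑ i ∈ S, Real.log (1 + b i / τ) := by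
  induction S using Finset.cons_induction with
  | empty => simp
  | cons i S hi ih =>
    obtain ⟨hbi, hbS⟩ := Finset.forall_mem_cons hi _ |>.1 hb
    have hAS : τ ≤ A + ∑ j ∈ S, b j := le_add_of_le_of_nonneg hA (Finset.sum_nonneg hbS)
    rw [Finset.sum_cons, Finset.sum_cons]
    calc Real.log (A + (b i + ∑ j ∈ S, b j)) = Real.log (A + ∑ j ∈ S, b j + b i) := by
          rw [add_comm (b i), add_assoc]
      _ ≤ Real.log (A + ∑ j ∈ S, b j) + Real.log (1 + b i / τ) := log_add_le hτ hAS hbi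
      _ ≤ Real.log A + (Real.log (1 + b i / τ) + ∑ j ∈ S, Real.log (1 + b j / τ)) := by
          linarith [ih hbS]

lemma pow_div_factorial_le_exp_sub {a : ℝ} (ha : 0 ≤ a) (k : ℕ) :
    a ^ k / k.factorial ≤ Real.exp (Real.exp 1 * a - k) := by
  have h := Real.pow_div_factorial_le_exp (Real.exp 1 * a) (by positivity) k
  rw [mul_pow, ← Real.exp_nat_mul, mul_one, mul_div_assoc] at h
  rwa [Real.exp_sub, le_div_iff₀' (Real.exp_pos _)]

lemma choose_mul_pow_le {q : ℝ} (hq : 0 ≤ q) {n k : ℕ} (hn : 1 ≤ n)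
    (hk : 3 * (n * q) + 4 * Real.log n ≤ k) :
    (n.choose (k + 1) : ℝ) * q ^ k ≤ 1 / (n : ℝ) ^ 3 := by
  have hn0 : (0 : ℝ) < n := by exact_mod_cast hn
  have hexp : Real.exp (-(4 * Real.log n)) = 1 / (n : ℝ) ^ 4 := by
    rw [Real.exp_neg, one_div]
    congr 1
    rw [← Real.exp_log hn0, ← Real.exp_nat_mul, Real.log_exp, Nat.cast_ofNat]
  calc (n.choose (k + 1) : ℝ) * q ^ k
      ≤ n ^ (k + 1) / (k + 1).factorial * q ^ k := by
        gcongr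
        exact Nat.choose_le_pow_div _ _
    _ ≤ n ^ (k + 1) / k.factorial * q ^ k := by
        gcongr
        exact k.le_succ
    _ = n * ((n * q) ^ k / k.factorial) := by ring
    _ ≤ n * Real.exp (-(4 * Real.log n)) := by
        gcongr
        refine (pow_div_factorial_le_exp_sub (by positivity) k).trans (Real.exp_le_exp.2 ?_)
        have : Real.exp 1 * (n * q) ≤ 3 * (n * q) := by
          gcongr
          exact (Real.exp_one_lt_d9.trans (by norm_num)).le
        linarith
    _ = 1 / (n : ℝ) ^ 3 := by
        rw [hexp]
        field_simp

/-! ### Densities and the laws they define -/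

/-- The measure on `ℝ` with Lebesgue density `p`; `mixtureLaw f θ` is the case
`p = mixture f θ`. -/
noncomputable def densityLaw (p : ℝ → ℝ) : Measure ℝ :=
  volume.withDensity fun x => ENNReal.ofReal (p x)

section Densities

variable {p q r : ℝ → ℝ}

lemma densityLaw_absolutelyContinuous : densityLaw p ≪ volume :=
  withDensity_absolutelyContinuous _ _

lemma densityLaw_le_smul {v : ℝ} (hv : ∀ x, p x ≤ v) :
    densityLaw p ≤ ENNReal.ofReal v • volume := by
  rw [← withDensity_const]
  exact withDensity_mono (.of_forall fun x => ENNReal.ofReal_le_ofReal (hv x))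

namespace IsDensity

lemma aemeasurable (hp : IsDensity p) : AEMeasurable p := hp.integrable.aemeasurable

lemma isProbabilityMeasure_densityLaw (hp : IsDensity p) :
    IsProbabilityMeasure (densityLaw p) := by
  refine ⟨?_⟩
  rw [densityLaw, withDensity_apply _ MeasurableSet.univ, setLIntegral_univ,
    ← ofReal_integral_eq_lintegral_ofReal hp.integrable (.of_forall hp.nonneg),
    hp.integral_eq_one, ENNReal.ofReal_one]

lemma ae_densityLaw_iff (hp : IsDensity p) {s : ℝ → Prop} :
    (∀ᵐ x ∂densityLaw p, s x) ↔ ∀ᵐ x, 0 < p x → s x := by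
  rw [densityLaw, ae_withDensity_iff' hp.aemeasurable.ennreal_ofReal]
  simp only [ne_eq, ENNReal.ofReal_eq_zero, not_le]

lemma ae_pos (hp : IsDensity p) : ∀ᵐ x ∂densityLaw p, 0 < p x :=
  hp.ae_densityLaw_iff.2 (.of_forall fun _ h => h)

lemma integrable_densityLaw (hp : IsDensity p) {h : ℝ → ℝ} (hm : AEMeasurable h)
    (hh : Integrable fun x => |h x| * p x) : Integrable h (densityLaw p) := by
  rw [densityLaw, integrable_withDensity_iff_integrable_smul₀' hp.aemeasurable.ennreal_ofReal
    (.of_forall fun _ => ENNReal.ofReal_lt_top)]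
  refine (integrable_norm_iff ?_).1 (hh.congr (.of_forall fun x => ?_))
  · exact (hp.aemeasurable.ennreal_ofReal.ennreal_toReal.mul hm).aestronglyMeasurable
  · beta_reduce
    rw [ENNReal.toReal_ofReal (hp.nonneg x), norm_smul,
      Real.norm_of_nonneg (hp.nonneg x), Real.norm_eq_abs, mul_comm]

lemma ae_eq_of_densityLaw_eq (hp : IsDensity p) (hr : IsDensity r)
    (h : densityLaw p = densityLaw r) : p =ᵐ[volume] r := by
  have := hp.isProbabilityMeasure_densityLaw
  have hfin : ∫⁻ x, ENNReal.ofReal (p x) ≠ ∞ := by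
    rw [← setLIntegral_univ, ← withDensity_apply _ MeasurableSet.univ]
    exact measure_ne_top (densityLaw p) _
  refine ((withDensity_eq_iff hp.aemeasurable.ennreal_ofReal hr.aemeasurable.ennreal_ofReal
    hfin).1 h).mono fun x hx => ?_
  exact (ENNReal.ofReal_eq_ofReal_iff (hp.nonneg x) (hr.nonneg x)).1 hx

lemma sum {ι : Type*} {s : Finset ι} {w : ι → ℝ} {g : ι → ℝ → ℝ} (hw : ∀ i ∈ s, 0 ≤ w i)
    (hw1 : ∑ i ∈ s, w i = 1) (hg : ∀ i ∈ s, IsDensity (g i)) :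
    IsDensity fun x => ∑ i ∈ s, w i * g i x where
  nonneg x := Finset.sum_nonneg fun i hi => mul_nonneg (hw i hi) ((hg i hi).nonneg x)
  integrable := integrable_finsetSum _ fun i hi => (hg i hi).integrable.const_mul _
  integral_eq_one := by
    rw [integral_finsetSum _ fun i hi => (hg i hi).integrable.const_mul _, ← hw1]
    exact Finset.sum_congr rfl fun i hi => by
      rw [integral_const_mul, (hg i hi).integral_eq_one, mul_one]

lemma midpoint (hp : IsDensity p) (hq : IsDensity q) : IsDensity fun x => (p x + q x) / 2 where
  nonneg x := div_nonneg (add_nonneg (hp.nonneg x) (hq.nonneg x)) zero_le_two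
  integrable := (hp.integrable.add hq.integrable).div_const 2
  integral_eq_one := by
    rw [integral_div, integral_add hp.integrable hq.integrable, hp.integral_eq_one,
      hq.integral_eq_one, add_self_div_two]

lemma locScale (hp : IsDensity p) (μ : ℝ) {σ : ℝ} (hσ : 0 < σ) :
    IsDensity (locScale p μ σ) where
  nonneg x := mul_nonneg (one_div_nonneg.2 hσ.le) (hp.nonneg _)
  integrable := ((hp.integrable.comp_div hσ.ne').comp_sub_right μ).const_mul (1 / σ)
  integral_eq_one := by
    unfold LocScaleMixture.locScale
    rw [integral_const_mul, integral_sub_right_eq_self (fun x => p (x / σ)) μ,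
      Measure.integral_comp_div, hp.integral_eq_one, abs_of_pos hσ, smul_eq_mul, mul_one,
      one_div_mul_cancel hσ.ne']

/-! ### The Kullback–Leibler gap -/

lemma densityLaw_eq_withDensity_div (hp : IsDensity p) (hr : IsDensity r) {C : ℝ}
    (hpr : ∀ x, p x ≤ C * r x) :
    densityLaw p = (densityLaw r).withDensity fun x => ENNReal.ofReal (p x / r x) := by
  have hdiv : AEMeasurable fun x => p x / r x := hp.aemeasurable.div hr.aemeasurable
  rw [densityLaw, densityLaw, ← withDensity_mul₀ hr.aemeasurable.ennreal_ofReal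
    hdiv.ennreal_ofReal]
  congr 1 with x
  rw [Pi.mul_apply, ← ENNReal.ofReal_mul (hr.nonneg x)]
  rcases eq_or_ne (r x) 0 with h0 | h0
  · have : p x ≤ 0 := by simpa only [h0, mul_zero] using hpr x
    rw [ENNReal.ofReal_of_nonpos this, h0, zero_mul, ENNReal.ofReal_zero]
  · rw [mul_div_cancel₀ _ h0]

lemma rnDeriv_densityLaw (hp : IsDensity p) (hr : IsDensity r) {C : ℝ}
    (hpr : ∀ x, p x ≤ C * r x) :
    (densityLaw p).rnDeriv (densityLaw r) =ᵐ[densityLaw r] fun x => ENNReal.ofReal (p x / r x) := by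
  have := hr.isProbabilityMeasure_densityLaw
  rw [hp.densityLaw_eq_withDensity_div hr hpr]
  exact Measure.rnDeriv_withDensity₀ _ ((hp.aemeasurable.div hr.aemeasurable).mono_ac
    densityLaw_absolutelyContinuous).ennreal_ofReal

lemma densityLaw_absolutelyContinuous_of_le (hp : IsDensity p) (hr : IsDensity r) {C : ℝ}
    (hpr : ∀ x, p x ≤ C * r x) : densityLaw p ≪ densityLaw r := by
  rw [hp.densityLaw_eq_withDensity_div hr hpr]
  exact withDensity_absolutelyContinuous _ _

lemma integrable_llr_densityLaw (hp : IsDensity p) (hr : IsDensity r) {C : ℝ}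
    (hpr : ∀ x, p x ≤ C * r x) :
    Integrable (llr (densityLaw p) (densityLaw r)) (densityLaw p) := by
  have := hp.isProbabilityMeasure_densityLaw
  have := hr.isProbabilityMeasure_densityLaw
  refine (InformationTheory.integrable_klFun_rnDeriv_iff
    (hp.densityLaw_absolutelyContinuous_of_le hr hpr)).1 ?_
  obtain ⟨B, hB⟩ := (isCompact_Icc (a := 0) (b := C)).exists_bound_of_continuousOn
    InformationTheory.continuous_klFun.continuousOn
  refine Integrable.of_bound (InformationTheory.continuous_klFun.measurable.comp
    (Measure.measurable_rnDeriv _ _).ennreal_toReal).aestronglyMeasurable B ?_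
  filter_upwards [hp.rnDeriv_densityLaw hr hpr, hr.ae_pos] with x hx hrx
  have hratio : 0 ≤ p x / r x := div_nonneg (hp.nonneg x) hrx.le
  rw [hx, ENNReal.toReal_ofReal hratio]
  exact hB _ ⟨hratio, (div_le_iff₀ hrx).2 (hpr x)⟩

lemma integral_log_div_neg (hp : IsDensity p) (hr : IsDensity r) {C : ℝ}
    (hpr : ∀ x, p x ≤ C * r x) (hne : ¬ r =ᵐ[volume] p) :
    ∫ x, Real.log (r x / p x) ∂densityLaw p < 0 := by
  have := hp.isProbabilityMeasure_densityLaw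
  have := hr.isProbabilityMeasure_densityLaw
  have hac := hp.densityLaw_absolutelyContinuous_of_le hr hpr
  have hkl : 0 < (InformationTheory.klDiv (densityLaw p) (densityLaw r)).toReal := by
    refine ENNReal.toReal_pos (fun h => hne ?_)
      (InformationTheory.klDiv_ne_top hac (hp.integrable_llr_densityLaw hr hpr))
    exact (hp.ae_eq_of_densityLaw_eq hr (InformationTheory.klDiv_eq_zero_iff.1 h)).symm
  rw [InformationTheory.toReal_klDiv_of_measure_eq hac
    (by rw [measure_univ, measure_univ])] at hkl
  rw [← neg_pos, ← integral_neg]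
  refine hkl.trans_eq (integral_congr_ae ?_)
  filter_upwards [hac.ae_le (hp.rnDeriv_densityLaw hr hpr)] with x hx
  rw [llr, hx, ENNReal.toReal_ofReal (div_nonneg (hp.nonneg x) (hr.nonneg x)), ← Real.log_inv,
    inv_div]

end IsDensity

lemma log_midpoint_div {a b : ℝ} (ha : 0 ≤ a) (hb : 0 < b) :
    Real.log ((a + b) / 2 / b) = Real.log (1 + a / b) - Real.log 2 := by
  rw [← Real.log_div (by positivity) two_ne_zero]
  congr 1
  field_simp
  ring

lemma abs_log_midpoint_div_le {a b C : ℝ} (ha : 0 ≤ a) (haC : a ≤ C) (hb : 0 < b) :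
    |Real.log ((a + b) / 2 / b)| ≤ Real.log 2 + (Real.log (1 + C) + |Real.log b|) := by
  have hupper : Real.log (1 + a / b) ≤ Real.log (1 + C) + |Real.log b| :=
    (log_one_add_div_le ha hb).trans (by gcongr)
  rw [log_midpoint_div ha hb, abs_le]
  constructor <;> linarith [Real.log_pos one_lt_two, log_one_add_div_nonneg ha hb.le]

lemma log_sub_log_le_two_mul_log_midpoint_div {a b : ℝ} (ha : 0 < a) (hb : 0 < b) :
    Real.log a - Real.log b ≤ 2 * Real.log ((a + b) / 2 / b) := by
  rw [← Real.log_div ha.ne' hb.ne', ← Nat.cast_ofNat, ← Real.log_pow]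
  refine Real.log_le_log (by positivity) ?_
  rw [div_pow, div_le_div_iff₀ hb (by positivity)]
  nlinarith [mul_nonneg hb.le (sq_nonneg (a - b))]

namespace IsDensity

variable {ι : Type*} {l : Filter ι} {g : ι → ℝ → ℝ} {C : ℝ}

lemma integrable_log_midpoint_div (hp : IsDensity p) {h : ℝ → ℝ}
    (hlog : Integrable (fun x => Real.log (p x)) (densityLaw p)) (hm : AEMeasurable h)
    (hh : ∀ x, 0 < h x ∧ h x ≤ C) :
    Integrable (fun x => Real.log ((h x + p x) / 2 / p x)) (densityLaw p) := by
  have := hp.isProbabilityMeasure_densityLaw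
  refine Integrable.mono' ((integrable_const (Real.log 2)).add
    ((integrable_const (Real.log (1 + C))).add hlog.abs)) ?_ ?_
  · exact (Real.measurable_log.comp_aemeasurable ((((hm.add hp.aemeasurable).div_const 2).div
      hp.aemeasurable).mono_ac densityLaw_absolutelyContinuous)).aestronglyMeasurable
  · filter_upwards [hp.ae_pos] with x hx
    exact abs_log_midpoint_div_le (hh x).1.le (hh x).2 hx

lemma tendsto_integral_log_midpoint_div [l.IsCountablyGenerated] (hp : IsDensity p)
    (hq : ∀ x, 0 ≤ q x) (hlog : Integrable (fun x => Real.log (p x)) (densityLaw p))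
    (hgm : ∀ᶠ i in l, AEMeasurable (g i)) (hg : ∀ᶠ i in l, ∀ x, 0 < g i x ∧ g i x ≤ C)
    (hgq : ∀ᵐ x, Tendsto (fun i => g i x) l (𝓝 (q x))) :
    Tendsto (fun i => ∫ x, Real.log ((g i x + p x) / 2 / p x) ∂densityLaw p) l
      (𝓝 (∫ x, Real.log ((q x + p x) / 2 / p x) ∂densityLaw p)) := by
  have := hp.isProbabilityMeasure_densityLaw
  have hac := densityLaw_absolutelyContinuous (p := p)
  refine tendsto_integral_filter_of_dominated_convergence
    (fun x => Real.log 2 + (Real.log (1 + C) + |Real.log (p x)|)) ?_ ?_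
    ((integrable_const _).add ((integrable_const _).add hlog.abs)) ?_
  · filter_upwards [hgm, hg] with i hm hb
    exact (hp.integrable_log_midpoint_div hlog hm hb).aestronglyMeasurable
  · filter_upwards [hg] with i hi
    filter_upwards [hp.ae_pos] with x hx
    exact abs_log_midpoint_div_le (hi x).1.le (hi x).2 hx
  · filter_upwards [hp.ae_pos, hac.ae_le hgq] with x hx hlim
    refine (((hlim.add_const _).div_const _).div_const _).log ?_
    have := hq x
    positivity

-- `log (g i / p)` need not be dominated from below; `log ((g i + p) / (2 p))` is, and by AM-GM
-- twice the latter bounds the former.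
lemma eventually_integral_log_lt [l.IsCountablyGenerated] (hp : IsDensity p) (hq : IsDensity q)
    (hne : ¬ q =ᵐ[volume] p) (hlog : Integrable (fun x => Real.log (p x)) (densityLaw p))
    (hgm : ∀ᶠ i in l, AEMeasurable (g i)) (hg : ∀ᶠ i in l, ∀ x, 0 < g i x ∧ g i x ≤ C)
    (hgi : ∀ᶠ i in l, Integrable (fun x => Real.log (g i x)) (densityLaw p))
    (hgq : ∀ᵐ x, Tendsto (fun i => g i x) l (𝓝 (q x))) :
    ∀ᶠ i in l, ∫ x, Real.log (g i x) ∂densityLaw p < ∫ x, Real.log (p x) ∂densityLaw p := by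
  have hne' : ¬ (fun x => (q x + p x) / 2) =ᵐ[volume] p := fun h =>
    hne (h.mono fun x hx => by linarith [show (q x + p x) / 2 = p x from hx])
  have hgap := hp.integral_log_div_neg (hq.midpoint hp) (C := 2)
    (fun x => by linarith [hq.nonneg x]) hne'
  filter_upwards [(hp.tendsto_integral_log_midpoint_div hq.nonneg hlog hgm hg
    hgq).eventually_lt_const hgap, hgm, hg, hgi] with i hi hm hb hint
  have hle : ∫ x, (Real.log (g i x) - Real.log (p x)) ∂densityLaw p ≤
      ∫ x, 2 * Real.log ((g i x + p x) / 2 / p x) ∂densityLaw p := by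
    refine integral_mono_ae (hint.sub hlog)
      ((hp.integrable_log_midpoint_div hlog hm hb).const_mul 2) ?_
    filter_upwards [hp.ae_pos] with x hx
    exact log_sub_log_le_two_mul_log_midpoint_div (hb x).1 hx
  rw [integral_sub hint hlog, integral_const_mul] at hle
  linarith

end IsDensity

end Densities

/-! ### Mixtures -/

section Mixtures

variable {M : ℕ} {f : Fin M → ℝ → ℝ} {θ θ₀ : Param M}

lemma isDensity_mixture (hf : ∀ m, IsDensity (f m)) (hθ : θ ∈ paramSpace M) :
    IsDensity (mixture f θ) :=
  IsDensity.sum (fun m _ => hθ.2.1 m) hθ.1 fun m _ => (hf m).locScale _ (hθ.2.2 m)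

lemma weight_le_one (hθ : θ ∈ paramSpace M) (m : Fin M) : weight θ m ≤ 1 :=
  hθ.1 ▸ Finset.single_le_sum (fun i _ => hθ.2.1 i) (Finset.mem_univ m)

lemma locScale_le {g : ℝ → ℝ} {v μ σ : ℝ} (hσ : 0 ≤ σ) (hg : ∀ x, g x ≤ v) (x : ℝ) :
    locScale g μ σ x ≤ v / σ := by
  rw [locScale, one_div_mul_eq_div]
  exact div_le_div_of_nonneg_right (hg _) hσ

lemma mixture_le {v s : ℝ} (hv : ∀ m x, f m x ≤ v) (hv0 : 0 ≤ v) (hs : 0 < s)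
    (hθ : θ ∈ paramSpace M) (hθs : ∀ m, s ≤ scale θ m) (x : ℝ) : mixture f θ x ≤ v / s := by
  calc mixture f θ x ≤ ∑ m, weight θ m * (v / s) := by
        unfold mixture subMixture
        gcongr with m
        · exact hθ.2.1 m
        · exact (locScale_le (hθ.2.2 m).le (hv m) x).trans
            (div_le_div_of_nonneg_left hv0 hs (hθs m))
    _ = v / s := by rw [← Finset.sum_mul, hθ.1, one_mul]

lemma exists_pos_le_scale (hθ : θ ∈ paramSpace M) : ∃ s > 0, ∀ m, s ≤ scale θ m := by
  rcases isEmpty_or_nonempty (Fin M) with h | h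
  · exact ⟨1, one_pos, h.elim⟩
  · obtain ⟨m, hm⟩ := Finite.exists_min (scale θ)
    exact ⟨scale θ m, hθ.2.2 m, hm⟩

lemma exists_pos_le_scale_of_mem_closedBall (hθ : θ ∈ paramSpace M) :
    ∃ s > 0, ∀ θ' ∈ Metric.closedBall θ s, ∀ m, s ≤ scale θ' m := by
  obtain ⟨s, hs, hθs⟩ := exists_pos_le_scale hθ
  refine ⟨s / 2, half_pos hs, fun θ' hθ' m => ?_⟩
  have hcoord : |θ' (m, 2) - θ (m, 2)| ≤ s / 2 := by
    rw [Metric.mem_closedBall, dist_eq_norm] at hθ'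
    exact (PiLp.norm_apply_le (θ' - θ) (m, 2)).trans hθ'
  have := hθs m
  unfold scale at *
  linarith [neg_le_of_abs_le hcoord]

lemma isCompact_closedBall_inter_paramSpace {s : ℝ} (hs : 0 < s)
    (hθs : ∀ θ' ∈ Metric.closedBall θ s, ∀ m, s ≤ scale θ' m) :
    IsCompact (Metric.closedBall θ s ∩ paramSpace M) := by
  have hset : Metric.closedBall θ s ∩ paramSpace M = Metric.closedBall θ s ∩
      {θ' | (∑ m, weight θ' m = 1) ∧ ∀ m, 0 ≤ weight θ' m} := by
    ext θ'
    refine and_congr_right fun h => ⟨fun h' => ⟨h'.1, h'.2.1⟩, fun h' => ⟨h'.1, h'.2, fun m => ?_⟩⟩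
    exact hs.trans_le (hθs θ' h m)
  rw [hset]
  refine (isCompact_closedBall _ _).inter_right (IsClosed.and ?_ ?_)
  · exact isClosed_eq (by unfold weight; fun_prop) continuous_const
  · simp only [Set.ofPred_forall]
    exact isClosed_iInter fun m => isClosed_le continuous_const (by unfold weight; fun_prop)

/-! ### Suprema over small balls -/

lemma ParamContinuous.ae_continuousWithinAt (h3 : ParamContinuous f) (hθ : θ ∈ paramSpace M) :
    ∀ᵐ x, ContinuousWithinAt (fun θ' => mixture f θ' x) (paramSpace M) θ := by
  obtain ⟨s, hs, hθs⟩ := exists_pos_le_scale_of_mem_closedBall hθ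
  obtain ⟨N, hN, hcont⟩ := h3 _ (isCompact_closedBall_inter_paramSpace hs hθs)
    Set.inter_subset_right θ ⟨Metric.mem_closedBall_self hs.le, hθ⟩
  filter_upwards [measure_eq_zero_iff_ae_notMem.1 hN] with x hx
  rw [← continuousWithinAt_inter (Metric.closedBall_mem_nhds θ hs), Set.inter_comm]
  refine tendsto_of_seq_tendsto fun u hu => ?_
  obtain ⟨hlim, hmem⟩ := tendsto_nhdsWithin_iff.1 hu
  obtain ⟨k, hk⟩ := eventually_atTop.1 hmem
  rw [← tendsto_add_atTop_iff_nat k]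
  exact hcont (fun j => u (j + k)) (fun j => hk _ (Nat.le_add_left k j))
    ((tendsto_add_atTop_iff_nat k).2 hlim) x hx

lemma ballSup_nonneg (hf : ∀ m, IsDensity (f m)) (θ : Param M) (ρ x : ℝ) : 0 ≤ ballSup f θ ρ x :=
  Real.iSup_nonneg fun θ' => (isDensity_mixture hf θ'.2.1).nonneg x

lemma mixture_le_ballSup {ρ x C : ℝ}
    (hC : ∀ θ' ∈ paramSpace M, dist θ' θ ≤ ρ → mixture f θ' x ≤ C)
    {θ' : Param M} (hθ' : θ' ∈ paramSpace M) (hd : dist θ' θ ≤ ρ) :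
    mixture f θ' x ≤ ballSup f θ ρ x :=
  le_ciSup (f := fun θ' : {θ' : Param M // θ' ∈ paramSpace M ∧ dist θ' θ ≤ ρ} => mixture f θ'.1 x)
    ⟨C, by rintro _ ⟨θ', rfl⟩; exact hC θ'.1 θ'.2.1 θ'.2.2⟩ ⟨θ', hθ', hd⟩

lemma ballSup_le (hθ : θ ∈ paramSpace M) {ρ x C : ℝ} (hρ : 0 ≤ ρ)
    (hC : ∀ θ' ∈ paramSpace M, dist θ' θ ≤ ρ → mixture f θ' x ≤ C) : ballSup f θ ρ x ≤ C :=
  have : Nonempty {θ' : Param M // θ' ∈ paramSpace M ∧ dist θ' θ ≤ ρ} :=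
    ⟨⟨θ, hθ, (dist_self θ).trans_le hρ⟩⟩
  ciSup_le fun θ' => hC θ'.1 θ'.2.1 θ'.2.2

lemma tendsto_ballSup (hθ : θ ∈ paramSpace M) {x : ℝ}
    (hx : ContinuousWithinAt (fun θ' => mixture f θ' x) (paramSpace M) θ) :
    Tendsto (fun ρ => ballSup f θ ρ x) (𝓝[>] 0) (𝓝 (mixture f θ x)) := by
  rw [Metric.tendsto_nhds]
  intro ε hε
  obtain ⟨δ, hδ, hclose⟩ := Metric.continuousWithinAt_iff.1 hx (ε / 2) (half_pos hε)
  filter_upwards [Ioo_mem_nhdsGT hδ] with ρ hρ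
  have hC : ∀ θ' ∈ paramSpace M, dist θ' θ ≤ ρ → mixture f θ' x ≤ mixture f θ x + ε / 2 := by
    intro θ' hθ' hd
    linarith [(abs_lt.1 (hclose hθ' (hd.trans_lt hρ.2))).2]
  have hlower := mixture_le_ballSup hC hθ ((dist_self θ).trans_le hρ.1.le)
  have hupper := ballSup_le hθ hρ.1.le hC
  rw [Real.dist_eq, abs_lt]
  constructor <;> linarith

lemma exists_eventually_mixture_le {v : ℝ} (hv : ∀ m x, f m x ≤ v) (hv0 : 0 ≤ v)
    (hθ : θ ∈ paramSpace M) :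
    ∃ C, ∀ᶠ ρ in 𝓝[>] (0 : ℝ), ∀ θ' ∈ paramSpace M, dist θ' θ ≤ ρ → ∀ x, mixture f θ' x ≤ C := by
  obtain ⟨s, hs, hθs⟩ := exists_pos_le_scale_of_mem_closedBall hθ
  refine ⟨v / s, ?_⟩
  filter_upwards [Ioo_mem_nhdsGT hs] with ρ hρ θ' hθ' hd
  exact mixture_le hv hv0 hs hθ' (hθs θ' (hd.trans hρ.2.le))

lemma integrable_log_add {ν : Measure ℝ} [IsFiniteMeasure ν] {h : ℝ → ℝ} {C τ : ℝ}
    (hm : AEMeasurable h ν) (h0 : ∀ x, 0 ≤ h x) (hC : ∀ x, h x ≤ C) (hτ : 0 < τ) :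
    Integrable (fun x => Real.log (h x + τ)) ν := by
  refine Integrable.of_mem_Icc (Real.log τ) (Real.log (C + τ))
    (Real.measurable_log.comp_aemeasurable (hm.add_const τ)) (.of_forall fun x => ⟨?_, ?_⟩)
  · exact Real.log_le_log hτ (le_add_of_nonneg_left (h0 x))
  · exact Real.log_le_log (add_pos_of_nonneg_of_pos (h0 x) hτ) (by grw [hC x])

lemma eventually_integral_log_ballSup_lt (hf : ∀ m, IsDensity (f m)) (hθ₀ : θ₀ ∈ paramSpace M)
    {v : ℝ} (hv : ∀ m x, f m x ≤ v) (hv0 : 0 ≤ v) (h2 : SupMeasurable f) (h3 : ParamContinuous f)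
    (h4 : LogIntegrable f θ₀) (hθ : θ ∈ paramSpace M)
    (hne : ¬ mixture f θ =ᵐ[volume] mixture f θ₀) :
    ∀ᶠ ρ in 𝓝[>] (0 : ℝ),
      (∀ θ' ∈ paramSpace M, dist θ' θ ≤ ρ → ∀ x, mixture f θ' x ≤ ballSup f θ ρ x) ∧
      Integrable (fun x => Real.log (ballSup f θ ρ x + ρ)) (densityLaw (mixture f θ₀)) ∧
      ∫ x, Real.log (ballSup f θ ρ x + ρ) ∂densityLaw (mixture f θ₀) <
        ∫ x, Real.log (mixture f θ₀ x) ∂densityLaw (mixture f θ₀) := by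
  have hp := isDensity_mixture hf hθ₀
  have := hp.isProbabilityMeasure_densityLaw
  have hlog := hp.integrable_densityLaw (Real.measurable_log.comp_aemeasurable hp.aemeasurable) h4
  obtain ⟨C, hC⟩ := exists_eventually_mixture_le hv hv0 hθ
  have hpos : ∀ᶠ ρ : ℝ in 𝓝[>] 0, 0 < ρ := self_mem_nhdsWithin
  have hle : ∀ᶠ ρ in 𝓝[>] (0 : ℝ), ∀ x, ballSup f θ ρ x ≤ C := by
    filter_upwards [hC, hpos] with ρ hρ h0 x
    exact ballSup_le hθ h0.le fun θ' hθ' hd => hρ θ' hθ' hd x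
  have hint : ∀ᶠ ρ in 𝓝[>] (0 : ℝ),
      Integrable (fun x => Real.log (ballSup f θ ρ x + ρ)) (densityLaw (mixture f θ₀)) := by
    filter_upwards [h2 θ hθ, hle, hpos] with ρ hm hρ h0
    exact integrable_log_add (hm.mono_ac densityLaw_absolutelyContinuous)
      (ballSup_nonneg hf θ ρ) hρ h0
  have hlt := hp.eventually_integral_log_lt (C := C + 1)
    (g := fun ρ x => ballSup f θ ρ x + ρ) (isDensity_mixture hf hθ) hne hlog
    ((h2 θ hθ).mono fun ρ hm => hm.add_const ρ)
    (by
      filter_upwards [hle, Ioo_mem_nhdsGT one_pos] with ρ hρ h01 x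
      exact ⟨add_pos_of_nonneg_of_pos (ballSup_nonneg hf θ ρ x) h01.1, add_le_add (hρ x) h01.2.le⟩)
    hint
    ((h3.ae_continuousWithinAt hθ).mono fun x hx => by
      simpa only [add_zero, id] using
        (tendsto_ballSup hθ hx).add (tendsto_id.mono_left nhdsWithin_le_nhds))
  filter_upwards [hC, hint, hlt] with ρ hρ hi hl
  exact ⟨fun θ' hθ' hd x => mixture_le_ballSup (fun θ'' h'' hd'' => hρ θ'' h'' hd'' x) hθ' hd,
    hi, hl⟩

end Mixtures

/-! ### Empirical means and counts -/

/-- The number of the first `n` terms of the sequence `x` that lie in `s`. -/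
noncomputable def hits {α : Type*} (x : ℕ → α) (n : ℕ) (s : Set α) : ℕ :=
  open Classical in ((Finset.range n).filter fun i => x i ∈ s).card

/-- The average of `h` over the first `n` terms of the sequence `x`; it is `0` for `n = 0`. -/
noncomputable def empiricalMean {α : Type*} (x : ℕ → α) (h : α → ℝ) (n : ℕ) : ℝ :=
  (∑ i ∈ Finset.range n, h (x i)) / n

section Counting

variable {α : Type*}

lemma hits_le (x : ℕ → α) (n : ℕ) (s : Set α) : hits x n s ≤ n := by
  classical
  simpa only [hits, Finset.card_range] using Finset.card_filter_le (Finset.range n) fun i => x i ∈ s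

lemma hits_mono (x : ℕ → α) (n : ℕ) {s t : Set α} (h : s ⊆ t) : hits x n s ≤ hits x n t := by
  classical
  exact Finset.card_le_card (Finset.monotone_filter_right _ fun _ _ hi => h hi)

lemma hits_union_le (x : ℕ → α) (n : ℕ) (s t : Set α) :
    hits x n (s ∪ t) ≤ hits x n s + hits x n t := by
  classical
  simp only [hits, Set.mem_union, Finset.filter_or]
  exact Finset.card_union_le _ _

lemma hits_div_le_one (x : ℕ → α) (n : ℕ) (s : Set α) : (hits x n s : ℝ) / n ≤ 1 :=
  div_le_one_of_le₀ (by exact_mod_cast hits_le x n s) n.cast_nonneg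

lemma empiricalMean_mono {x : ℕ → α} {g h : α → ℝ} {n : ℕ}
    (hgh : ∀ i ∈ Finset.range n, g (x i) ≤ h (x i)) :
    empiricalMean x g n ≤ empiricalMean x h n :=
  div_le_div_of_nonneg_right (Finset.sum_le_sum hgh) n.cast_nonneg

lemma empiricalMean_add (x : ℕ → α) (g h : α → ℝ) (n : ℕ) :
    empiricalMean x (fun y => g y + h y) n = empiricalMean x g n + empiricalMean x h n := by
  simp only [empiricalMean, Finset.sum_add_distrib, add_div]

lemma empiricalMean_sum {ι : Type*} (x : ℕ → α) (S : Finset ι) (h : ι → α → ℝ) (n : ℕ) :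
    empiricalMean x (fun y => ∑ m ∈ S, h m y) n = ∑ m ∈ S, empiricalMean x (h m) n := by
  simp only [empiricalMean]
  rw [Finset.sum_comm, Finset.sum_div]

lemma empiricalMean_indicator_const (x : ℕ → α) (s : Set α) (c : ℝ) (n : ℕ) :
    empiricalMean x (s.indicator fun _ => c) n = hits x n s / n * c := by
  classical
  simp only [empiricalMean, hits, Set.indicator_apply]
  rw [← Finset.sum_filter, Finset.sum_const, nsmul_eq_mul, mul_div_right_comm]

end Counting

section Sampling

variable {Ω : Type*} [MeasurableSpace Ω] {P : Measure Ω}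

section LawOfLargeNumbers

variable {α : Type*} [MeasurableSpace α] {X : ℕ → Ω → α} {ν : Measure α}

lemma ae_forall_of_hasLaw (hlaw : ∀ i, HasLaw (X i) ν P) {p : α → Prop} (hp : ∀ᵐ x ∂ν, p x) :
    ∀ᵐ ω ∂P, ∀ i, p (X i ω) :=
  ae_all_iff.2 fun i => ae_of_ae_map (hlaw i).aemeasurable ((hlaw i).map_eq ▸ hp)

theorem ae_tendsto_empiricalMean (hindep : iIndepFun X P) (hlaw : ∀ i, HasLaw (X i) ν P)
    {h : α → ℝ} (hh : Integrable h ν) :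
    ∀ᵐ ω ∂P, Tendsto (empiricalMean (fun i => X i ω) h) atTop (𝓝 (∫ x, h x ∂ν)) := by
  obtain ⟨g, hg, hgh⟩ := hh.aestronglyMeasurable
  have hident : ∀ i, IdentDistrib (g ∘ X i) (g ∘ X 0) P P := fun i =>
    (IdentDistrib.mk (hlaw i).aemeasurable (hlaw 0).aemeasurable
      ((hlaw i).map_eq.trans (hlaw 0).map_eq.symm)).comp hg.measurable
  have hint : Integrable (g ∘ X 0) P :=
    Integrable.comp_aemeasurable ((hlaw 0).map_eq.symm ▸ hh.congr hgh) (hlaw 0).aemeasurable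
  have hmean : ∫ ω, (g ∘ X 0) ω ∂P = ∫ x, h x ∂ν :=
    ((hlaw 0).integral_comp hg.aestronglyMeasurable).trans (integral_congr_ae hgh.symm)
  have hslln := strong_law_ae_real (fun i => g ∘ X i) hint
    (fun i j hij => (hindep.indepFun hij).comp hg.measurable hg.measurable) hident
  filter_upwards [hslln, ae_forall_of_hasLaw hlaw hgh] with ω hω hgX
  unfold empiricalMean
  rw [hmean] at hω
  simpa only [hgX, Function.comp_apply] using hω

lemma measure_le_hits (hindep : iIndepFun X P) (hlaw : ∀ i, HasLaw (X i) ν P) (n k : ℕ)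
    {s : Set α} (hs : MeasurableSet s) :
    P {ω | k ≤ hits (fun i => X i ω) n s} ≤ n.choose k * ν s ^ k := by
  classical
  have hsub : {ω | k ≤ hits (fun i => X i ω) n s} ⊆
      ⋃ S ∈ (Finset.range n).powersetCard k, ⋂ i ∈ S, X i ⁻¹' s := by
    intro ω hω
    obtain ⟨S, hS, hcard⟩ := Finset.exists_subset_card_eq (Set.mem_ofPred_eq ▸ hω)
    simp only [Set.mem_iUnion, Set.mem_iInter, Finset.mem_powersetCard]
    exact ⟨S, ⟨hS.trans (Finset.filter_subset _ _), hcard⟩,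
      fun i hi => (Finset.mem_filter.1 (hS hi)).2⟩
  have hpreimage : ∀ i, P (X i ⁻¹' s) = ν s := fun i => by
    rw [← (hlaw i).map_eq, Measure.map_apply_of_aemeasurable (hlaw i).aemeasurable hs]
  have hprob : ∀ S ∈ (Finset.range n).powersetCard k, P (⋂ i ∈ S, X i ⁻¹' s) = ν s ^ k := by
    intro S hS
    rw [hindep.measure_inter_preimage_eq_mul S fun _ _ => hs,
      Finset.prod_congr rfl fun i _ => hpreimage i, Finset.prod_const,
      (Finset.mem_powersetCard.1 hS).2]
  refine (measure_mono hsub).trans ((measure_biUnion_finset_le _ _).trans ?_)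
  rw [Finset.sum_congr rfl hprob, Finset.sum_const, Finset.card_powersetCard, Finset.card_range,
    nsmul_eq_mul]

end LawOfLargeNumbers

variable {X : ℕ → Ω → ℝ} {ν : Measure ℝ}

/-- The empirical measures of `x` are asymptotically tight. -/
def HasTightHits (x : ℕ → ℝ) : Prop :=
  ∀ ε > 0, ∃ A : ℝ, ∀ᶠ n : ℕ in atTop, (hits x n (Metric.closedBall 0 A)ᶜ : ℝ) / n < ε

lemma ae_hasTightHits [IsProbabilityMeasure ν] (hindep : iIndepFun X P)
    (hlaw : ∀ i, HasLaw (X i) ν P) : ∀ᵐ ω ∂P, HasTightHits fun i => X i ω := by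
  have htight : Tendsto (fun r : ℝ => ν.real (Metric.closedBall 0 r)ᶜ) atTop (𝓝 0) := by
    have := tendsto_measure_compl_closedBall_of_isTightMeasureSet
      (isTightMeasureSet_singleton (μ := ν)) (0 : ℝ)
    simp only [Set.mem_singleton_iff, iSup_iSup_eq_left] at this
    simpa only [ENNReal.toReal_zero, Function.comp_def, Measure.real] using
      (ENNReal.tendsto_toReal ENNReal.zero_ne_top).comp this
  have hfreq := ae_all_iff.2 fun A : ℕ => ae_tendsto_empiricalMean hindep hlaw
    ((integrable_const (1 : ℝ)).indicator (Metric.isClosed_closedBall (x := (0 : ℝ))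
      (ε := A)).measurableSet.compl)
  filter_upwards [hfreq] with ω hω ε hε
  obtain ⟨A, hA⟩ := (tendsto_natCast_atTop_atTop.eventually
    (htight.eventually_lt_const hε)).exists
  refine ⟨A, ?_⟩
  have hlim := hω A
  rw [integral_indicator_const _ Metric.isClosed_closedBall.measurableSet.compl, smul_eq_mul,
    mul_one] at hlim
  filter_upwards [hlim.eventually_lt_const hA] with n hn
  rwa [empiricalMean_indicator_const, mul_one] at hn

/-! ### Observations in short intervals -/

/-- The `i`-th cell `[i δ, (i + 1) δ)` of the partition of the line into intervals of length `δ`. -/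
def cell (δ : ℝ) (i : ℤ) : Set ℝ := {x | ⌊x / δ⌋ = i}

lemma measurableSet_cell (δ : ℝ) (i : ℤ) : MeasurableSet (cell δ i) :=
  (Int.measurable_floor.comp (measurable_id.div_const δ)) (measurableSet_singleton i)

lemma pairwise_disjoint_cell (δ : ℝ) : Pairwise (Function.onFun Disjoint (cell δ)) :=
  fun _ _ hij => Set.disjoint_left.2 fun _ hi hj => hij (hi.symm.trans hj)

lemma volume_cell {δ : ℝ} (hδ : 0 < δ) (i : ℤ) : volume (cell δ i) = ENNReal.ofReal δ := by
  have hIco : cell δ i = Set.Ico (i * δ) ((i + 1) * δ) := by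
    ext x
    simp only [cell, Set.mem_ofPred_eq, Int.floor_eq_iff, le_div_iff₀ hδ, div_lt_iff₀ hδ,
      Set.mem_Ico]
  rw [hIco, Real.volume_Ico, ← sub_mul, add_sub_cancel_left, one_mul]

lemma closedBall_subset_cell_union_cell {a ℓ δ : ℝ} (hδ : 0 < δ) (hℓ : 2 * ℓ ≤ δ) :
    ∃ i, Metric.closedBall a ℓ ⊆ cell δ i ∪ cell δ (i + 1) := by
  refine ⟨⌊(a - ℓ) / δ⌋, fun x hx => ?_⟩
  rw [Real.closedBall_eq_Icc] at hx
  have hlower : ⌊(a - ℓ) / δ⌋ ≤ ⌊x / δ⌋ :=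
    Int.floor_mono (div_le_div_of_nonneg_right hx.1 hδ.le)
  have hupper : ⌊x / δ⌋ ≤ ⌊(a - ℓ) / δ⌋ + 1 := by
    rw [← Int.floor_add_one, div_add_one hδ.ne']
    exact Int.floor_mono (div_le_div_of_nonneg_right (by linarith [hx.2]) hδ.le)
  simp only [cell, Set.mem_union, Set.mem_ofPred_eq]
  omega

lemma measure_exists_lt_hits_cell_le [IsProbabilityMeasure ν] (hindep : iIndepFun X P)
    (hlaw : ∀ i, HasLaw (X i) ν P) (n k : ℕ) {δ : ℝ} {q : ℝ≥0∞} (hq : ∀ i, ν (cell δ i) ≤ q) :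
    P {ω | ∃ i, k < hits (fun i => X i ω) n (cell δ i)} ≤ n.choose (k + 1) * q ^ k := by
  rw [Set.ofPred_exists]
  calc P (⋃ i, {ω | k < hits (fun i => X i ω) n (cell δ i)})
      ≤ ∑' i, P {ω | k < hits (fun i => X i ω) n (cell δ i)} := measure_iUnion_le _
    _ ≤ ∑' i, n.choose (k + 1) * q ^ k * ν (cell δ i) := by
        refine ENNReal.tsum_le_tsum fun i => ?_
        refine (measure_le_hits hindep hlaw n (k + 1) (measurableSet_cell δ i)).trans ?_
        rw [pow_succ, mul_assoc]
        gcongr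
        exact hq i
    _ = n.choose (k + 1) * q ^ k * ∑' i, ν (cell δ i) := ENNReal.tsum_mul_left
    _ ≤ n.choose (k + 1) * q ^ k := by
        refine mul_le_of_le_one_right' ?_
        rw [← measure_iUnion (pairwise_disjoint_cell δ) (measurableSet_cell δ)]
        exact prob_le_one

/-- The occupation number allowed for a cell of length `δ` among `n` observations from a density
bounded by `v`: a multiple of the expected number, plus a logarithmic term. -/
noncomputable def cellCap (v : ℝ) (n : ℕ) (δ : ℝ) : ℕ := ⌈3 * (n * (v * δ)) + 4 * Real.log n⌉₊

lemma measure_exists_cellCap_lt_hits_le [IsProbabilityMeasure ν] (hindep : iIndepFun X P)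
    (hlaw : ∀ i, HasLaw (X i) ν P) {v : ℝ} (hv : 0 ≤ v) (hν : ν ≤ ENNReal.ofReal v • volume)
    {n : ℕ} (hn : 1 ≤ n) {δ : ℝ} (hδ : 0 < δ) :
    P {ω | ∃ i, cellCap v n δ < hits (fun i => X i ω) n (cell δ i)} ≤
      ENNReal.ofReal (1 / (n : ℝ) ^ 3) := by
  have hq : ∀ i, ν (cell δ i) ≤ ENNReal.ofReal (v * δ) := fun i => by
    refine (hν _).trans_eq ?_
    rw [Measure.smul_apply, volume_cell hδ, smul_eq_mul, ENNReal.ofReal_mul hv]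
  refine (measure_exists_lt_hits_cell_le hindep hlaw n (cellCap v n δ) hq).trans ?_
  rw [← ENNReal.ofReal_pow (by positivity), ← ENNReal.ofReal_natCast,
    ← ENNReal.ofReal_mul (by positivity)]
  exact ENNReal.ofReal_le_ofReal (choose_mul_pow_le (by positivity) hn (Nat.le_ceil _))

lemma measure_exists_grid_cellCap_lt_hits_le [IsProbabilityMeasure ν] (hindep : iIndepFun X P)
    (hlaw : ∀ i, HasLaw (X i) ν P) {v : ℝ} (hv : 0 ≤ v) (hν : ν ≤ ENNReal.ofReal v • volume)
    (n : ℕ) :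
    P {ω | ∃ j ∈ Finset.Icc 1 n, ∃ i,
      cellCap v n (j / n) < hits (fun i => X i ω) n (cell (j / n) i)} ≤
      ENNReal.ofReal (1 / (n : ℝ) ^ 2) := by
  have hunion : {ω | ∃ j ∈ Finset.Icc 1 n, ∃ i,
      cellCap v n (j / n) < hits (fun i => X i ω) n (cell (j / n) i)} =
      ⋃ j ∈ Finset.Icc 1 n, {ω | ∃ i,
        cellCap v n (j / n) < hits (fun i => X i ω) n (cell (j / n) i)} := by
    ext ω
    simp only [Set.mem_ofPred_eq, Set.mem_iUnion, exists_prop]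
  calc _ ≤ ∑ j ∈ Finset.Icc 1 n, P {ω | ∃ i,
        cellCap v n (j / n) < hits (fun i => X i ω) n (cell (j / n) i)} :=
        hunion ▸ measure_biUnion_finset_le _ _
    _ ≤ ∑ j ∈ Finset.Icc 1 n, ENNReal.ofReal (1 / (n : ℝ) ^ 3) := by
        refine Finset.sum_le_sum fun j hj => ?_
        obtain ⟨hj1, hjn⟩ := Finset.mem_Icc.1 hj
        have hn : 0 < n := hj1.trans hjn
        exact measure_exists_cellCap_lt_hits_le hindep hlaw hv hν hn (by positivity)
    _ = ENNReal.ofReal (1 / (n : ℝ) ^ 2) := by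
        rw [Finset.sum_const, Nat.card_Icc, Nat.add_sub_cancel, nsmul_eq_mul,
          ← ENNReal.ofReal_natCast, ← ENNReal.ofReal_mul (by positivity)]
        congr 1
        rcases eq_or_ne (n : ℝ) 0 with h0 | h0
        · simp only [h0, zero_mul, ne_eq, OfNat.ofNat_ne_zero, not_false_eq_true, zero_pow,
            div_zero]
        · field_simp

/-- Each interval of radius `ℓ ≤ 1/2` contains at most a multiple of `n ℓ + log n` of the first `n`
terms of the sequence. -/
def HasSparseHits (x : ℕ → ℝ) : Prop :=
  ∃ C : ℝ, 0 ≤ C ∧ ∀ᶠ n : ℕ in atTop, ∀ a ℓ : ℝ, 0 < ℓ → ℓ ≤ 1 / 2 →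
    (hits x n (Metric.closedBall a ℓ) : ℝ) ≤ C * (n * ℓ + Real.log n)

lemma hits_closedBall_le_of_hits_cell_le {x : ℕ → ℝ} {v : ℝ} (hv : 0 ≤ v) {n : ℕ} (hn : 3 ≤ n)
    (hx : ∀ j ∈ Finset.Icc 1 n, ∀ i, hits x n (cell (j / n) i) ≤ cellCap v n (j / n))
    {a ℓ : ℝ} (hℓ : 0 < ℓ) (hℓ' : ℓ ≤ 1 / 2) :
    (hits x n (Metric.closedBall a ℓ) : ℝ) ≤ (12 * v + 10) * (n * ℓ + Real.log n) := by
  have hn0 : (0 : ℝ) < n := by positivity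
  have hlog : 1 ≤ Real.log n := by
    rw [Real.le_log_iff_exp_le hn0]
    exact (Real.exp_one_lt_d9.le.trans (by norm_num)).trans (Nat.cast_le (α := ℝ).2 hn)
  set j := ⌈2 * ℓ * n⌉₊
  have hj1 : 1 ≤ j := Nat.one_le_ceil_iff.2 (by positivity)
  have hjn : j ≤ n := Nat.ceil_le.2 (mul_le_of_le_one_left hn0.le (by linarith))
  have hj_lt : (j : ℝ) < 2 * ℓ * n + 1 := Nat.ceil_lt_add_one (by positivity)
  obtain ⟨i, hi⟩ := closedBall_subset_cell_union_cell (a := a) (δ := j / n) (by positivity)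
    ((le_div_iff₀ hn0).2 (Nat.le_ceil _))
  have hcells := hx j (Finset.mem_Icc.2 ⟨hj1, hjn⟩)
  have hcount : hits x n (Metric.closedBall a ℓ) ≤ cellCap v n (j / n) + cellCap v n (j / n) :=
    ((hits_mono x n hi).trans (hits_union_le x n _ _)).trans
      (add_le_add (hcells i) (hcells (i + 1)))
  have hcap : (cellCap v n (j / n) : ℝ) < 3 * (v * j) + 4 * Real.log n + 1 := by
    refine (Nat.ceil_lt_add_one (by positivity)).trans_eq ?_
    field_simp
  calc (hits x n (Metric.closedBall a ℓ) : ℝ)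
      ≤ cellCap v n (j / n) + cellCap v n (j / n) := by exact_mod_cast hcount
    _ ≤ 2 * (3 * (v * (2 * ℓ * n + 1)) + 4 * Real.log n + 1) := by
        linarith [mul_le_mul_of_nonneg_left hj_lt.le hv]
    _ ≤ (12 * v + 10) * (n * ℓ + Real.log n) := by
        nlinarith [mul_nonneg hv (sub_nonneg.2 hlog), mul_pos hn0 hℓ]

theorem ae_hasSparseHits [IsProbabilityMeasure ν] (hindep : iIndepFun X P)
    (hlaw : ∀ i, HasLaw (X i) ν P) {v : ℝ} (hv : 0 ≤ v) (hν : ν ≤ ENNReal.ofReal v • volume) :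
    ∀ᵐ ω ∂P, HasSparseHits fun i => X i ω := by
  have hsum : ∑' n, P {ω | ∃ j ∈ Finset.Icc 1 n, ∃ i,
      cellCap v n (j / n) < hits (fun i => X i ω) n (cell (j / n) i)} ≠ ∞ :=
    ne_top_of_le_ne_top (Real.summable_one_div_nat_pow.2 one_lt_two).tsum_ofReal_ne_top
      (ENNReal.tsum_le_tsum (measure_exists_grid_cellCap_lt_hits_le hindep hlaw hv hν))
  filter_upwards [ae_eventually_notMem hsum] with ω hω
  refine ⟨12 * v + 10, by positivity, ?_⟩
  filter_upwards [hω, eventually_ge_atTop 3] with n hn hn3 a ℓ hℓ hℓ'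
  simp only [not_exists, not_and, not_lt] at hn
  exact hits_closedBall_le_of_hits_cell_le hv hn3 hn hℓ hℓ'

end Sampling

/-! ### Degenerating components -/

/-- The distance from its location beyond which a component of scale `σ` with the tail bound
`v |x| ^ (-β)` is at most `η`. -/
noncomputable def tailRadius (v β η σ : ℝ) : ℝ := (v / η) ^ (1 / β) * σ ^ ((β - 1) / β)

/-- Bound on what a component with location `μ` and scale `σ` can add to the mean log-likelihood of
the first `n` observations: only those within the tail radius count, each with at most
`log (1 + a / σ)`. -/
noncomputable def componentGain (v β η a : ℝ) (x : ℕ → ℝ) (n : ℕ) (μ σ : ℝ) : ℝ :=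
  hits x n (Metric.closedBall μ (tailRadius v β η σ)) / n * Real.log (1 + a / σ)

/-- Locations `μ` and scales `σ > 0` that leave, along the filter `l`, every compact subset of
`ℝ × (0, ∞)`. Only sequences that converge in the compactification are of interest, and the three
cases are those that can then occur. -/
def IsDegenerating {ι : Type*} (l : Filter ι) (μ σ : ι → ℝ) : Prop :=
  Tendsto σ l (𝓝 0) ∨ Tendsto σ l atTop ∨
    (Tendsto (fun k => |μ k|) l atTop ∧ ∃ s > 0, Tendsto σ l (𝓝 s))

section Degenerating

variable {v β η a : ℝ}

lemma tailRadius_pos {σ : ℝ} (hv : 0 < v) (hη : 0 < η) (hσ : 0 < σ) : 0 < tailRadius v β η σ := by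
  unfold tailRadius
  positivity

lemma continuous_tailRadius (v η : ℝ) (hβ : 1 < β) : Continuous (tailRadius v β η) :=
  continuous_const.mul (Real.continuous_rpow_const
    (div_nonneg (sub_nonneg.2 hβ.le) (zero_le_one.trans hβ.le)))

lemma tailRadius_zero (v η : ℝ) (hβ : 1 < β) : tailRadius v β η 0 = 0 := by
  rw [tailRadius, Real.zero_rpow (div_pos (sub_pos.2 hβ) (one_pos.trans hβ)).ne', mul_zero]

lemma mul_tailRadius_rpow_neg {σ : ℝ} (hv : 0 < v) (hη : 0 < η) (hσ : 0 < σ) (hβ : 1 < β) :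
    v * tailRadius v β η σ ^ (-β) = η * σ ^ (1 - β) := by
  have hβ0 : β ≠ 0 := (one_pos.trans hβ).ne'
  rw [tailRadius, Real.mul_rpow (by positivity) (by positivity), ← Real.rpow_mul (by positivity),
    ← Real.rpow_mul hσ.le, mul_neg, mul_neg, div_mul_cancel₀ _ hβ0, div_mul_cancel₀ _ hβ0, neg_sub,
    Real.rpow_neg_one]
  field_simp

lemma locScale_le_of_tailRadius_lt {g : ℝ → ℝ} {μ σ x : ℝ} (hv : 0 < v) (hβ : 1 < β) (hη : 0 < η)
    (hσ : 0 < σ) (hg : ∀ x, x ≠ 0 → g x ≤ v * |x| ^ (-β)) (hx : tailRadius v β η σ < |x - μ|) :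
    locScale g μ σ x ≤ η := by
  have hr : 0 < tailRadius v β η σ := tailRadius_pos hv hη hσ
  have hxμ : 0 < |x - μ| := hr.trans hx
  have hpow : |x - μ| ^ (-β) ≤ tailRadius v β η σ ^ (-β) :=
    Real.rpow_le_rpow_of_nonpos hr hx.le (by linarith)
  rw [locScale, one_div_mul_eq_div, div_le_iff₀ hσ]
  calc g ((x - μ) / σ) ≤ v * |(x - μ) / σ| ^ (-β) := hg _ (div_ne_zero (abs_pos.1 hxμ) hσ.ne')
    _ = v * |x - μ| ^ (-β) * σ ^ β := by
        rw [abs_div, abs_of_pos hσ, Real.div_rpow hxμ.le hσ.le, Real.rpow_neg hσ.le, div_inv_eq_mul,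
          mul_assoc]
    _ ≤ v * tailRadius v β η σ ^ (-β) * σ ^ β := by
        gcongr
    _ = η * σ := by
        rw [mul_tailRadius_rpow_neg hv hη hσ hβ, mul_assoc, ← Real.rpow_add hσ, sub_add_cancel,
          Real.rpow_one]

lemma locScale_le_add_indicator {g : ℝ → ℝ} {b μ σ : ℝ} (hv : 0 < v) (hβ : 1 < β) (hη : 0 < η)
    (hσ : 0 < σ) (hb : ∀ x, g x ≤ b) (hg : ∀ x, x ≠ 0 → g x ≤ v * |x| ^ (-β)) (x : ℝ) :
    locScale g μ σ x ≤
      η + (Metric.closedBall μ (tailRadius v β η σ)).indicator (fun _ => b / σ) x := by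
  by_cases hx : x ∈ Metric.closedBall μ (tailRadius v β η σ)
  · rw [Set.indicator_of_mem hx]
    exact (locScale_le hσ.le hb x).trans (le_add_of_nonneg_left hη.le)
  · rw [Set.indicator_of_notMem hx, add_zero]
    rw [Metric.mem_closedBall, not_le, Real.dist_eq] at hx
    exact locScale_le_of_tailRadius_lt hv hβ hη hσ hg hx

lemma componentGain_nonneg {σ : ℝ} (ha : 0 ≤ a) (hσ : 0 ≤ σ) (x : ℕ → ℝ) (n : ℕ) (μ : ℝ) :
    0 ≤ componentGain v β η a x n μ σ :=
  mul_nonneg (by positivity) (log_one_add_div_nonneg ha hσ)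

section Limits

variable {ι : Type*} {l : Filter ι} {x : ℕ → ℝ} {n : ι → ℕ} {μ σ : ι → ℝ}

lemma tendsto_componentGain_of_scale_atTop (ha : 0 ≤ a) (hσ : Tendsto σ l atTop) :
    Tendsto (fun k => componentGain v β η a x (n k) (μ k) (σ k)) l (𝓝 0) := by
  have hlog : Tendsto (fun k => Real.log (1 + a / σ k)) l (𝓝 0) := by
    simpa using ((tendsto_const_nhds (x := (1 : ℝ))).add (hσ.const_div_atTop a)).log (by norm_num)
  refine squeeze_zero' ?_ ?_ hlog
  all_goals filter_upwards [hσ.eventually_ge_atTop 0] with k hk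
  · exact componentGain_nonneg ha hk _ _ _
  · exact mul_le_of_le_one_left (log_one_add_div_nonneg ha hk) (hits_div_le_one _ _ _)

lemma tendsto_hits_closedBall_div (hx : HasTightHits x) (hn : Tendsto n l atTop)
    (hμ : Tendsto (fun k => |μ k|) l atTop) {r : ι → ℝ} {R : ℝ} (hr : Tendsto r l (𝓝 R)) :
    Tendsto (fun k => (hits x (n k) (Metric.closedBall (μ k) (r k)) : ℝ) / n k) l (𝓝 0) := by
  refine tendsto_order.2 ⟨fun ε hε => .of_forall fun k => hε.trans_le (by positivity),
    fun ε hε => ?_⟩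
  obtain ⟨A, hA⟩ := hx ε hε
  filter_upwards [hn.eventually hA, hr.eventually_lt_const (lt_add_one R),
    hμ.eventually_gt_atTop ((R + 1) + A)] with k hk hrk hμk
  have hdisj : Disjoint (Metric.closedBall (μ k) (r k)) (Metric.closedBall 0 A) := by
    refine Metric.closedBall_disjoint_closedBall ?_
    rw [dist_zero_right, Real.norm_eq_abs]
    linarith
  refine lt_of_le_of_lt ?_ hk
  gcongr
  exact hits_mono _ _ hdisj.subset_compl_right

lemma tendsto_componentGain_of_loc_atTop (hx : HasTightHits x) (hn : Tendsto n l atTop)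
    (hβ : 1 < β) (hμ : Tendsto (fun k => |μ k|) l atTop) (ha : 0 ≤ a) {s : ℝ} (hs : 0 < s)
    (hσ : Tendsto σ l (𝓝 s)) :
    Tendsto (fun k => componentGain v β η a x (n k) (μ k) (σ k)) l (𝓝 0) := by
  have hlog : Tendsto (fun k => Real.log (1 + a / σ k)) l (𝓝 (Real.log (1 + a / s))) :=
    (tendsto_const_nhds.add (tendsto_const_nhds.div hσ hs.ne')).log (by positivity)
  have hradius : Tendsto (fun k => tailRadius v β η (σ k)) l (𝓝 (tailRadius v β η s)) :=
    ((continuous_tailRadius v η hβ).tendsto s).comp hσ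
  have hlim := (tendsto_hits_closedBall_div hx hn hμ hradius).mul hlog
  rwa [zero_mul] at hlim

lemma componentGain_le {C c m s : ℝ} {j : ℕ} (ha : 0 ≤ a) (hC : 0 ≤ C) (hc : 0 < c) (hcs : c ≤ s)
    (hj : 1 ≤ j) (hhits : (hits x j (Metric.closedBall m (tailRadius v β η s)) : ℝ) ≤
      C * (j * tailRadius v β η s + Real.log j)) :
    componentGain v β η a x j m s ≤
      C * (tailRadius v β η s * Real.log (1 + a / s)) +
        C * (Real.log j / j * Real.log (1 + a) + |Real.log j / j * Real.log c|) := by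
  have hj0 : (0 : ℝ) < j := by exact_mod_cast hj
  have hs : 0 < s := hc.trans_le hcs
  have hlogj : 0 ≤ Real.log j / j := div_nonneg (Real.log_natCast_nonneg j) hj0.le
  have hlog : 0 ≤ Real.log (1 + a / s) := log_one_add_div_nonneg ha hs.le
  have hlogs : Real.log (1 + a / s) ≤ Real.log (1 + a) + |Real.log c| := by
    refine (Real.log_le_log (by positivity) ?_).trans (log_one_add_div_le ha hc)
    gcongr
  calc componentGain v β η a x j m s
      ≤ C * (j * tailRadius v β η s + Real.log j) / j * Real.log (1 + a / s) := by
        unfold componentGain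
        gcongr
    _ = C * (tailRadius v β η s * Real.log (1 + a / s)) +
          C * (Real.log j / j * Real.log (1 + a / s)) := by
        field_simp
    _ ≤ C * (tailRadius v β η s * Real.log (1 + a / s)) +
          C * (Real.log j / j * (Real.log (1 + a) + |Real.log c|)) := by
        gcongr
    _ = C * (tailRadius v β η s * Real.log (1 + a / s)) +
          C * (Real.log j / j * Real.log (1 + a) + |Real.log j / j * Real.log c|) := by
        rw [abs_mul, abs_of_nonneg hlogj, mul_add (Real.log j / j)]

lemma tendsto_componentGain_of_scale_zero (hx : HasSparseHits x) (hn : Tendsto n l atTop)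
    {c : ℕ → ℝ} (hc : Tendsto (fun n : ℕ => Real.log n / n * Real.log (c n)) atTop (𝓝 0))
    (hc0 : ∀ n, 0 < c n) (hcσ : ∀ᶠ k in l, c (n k) ≤ σ k) (hv : 0 < v) (hβ : 1 < β) (hη : 0 < η)
    (ha : 0 ≤ a) (hσ : Tendsto σ l (𝓝 0)) :
    Tendsto (fun k => componentGain v β η a x (n k) (μ k) (σ k)) l (𝓝 0) := by
  obtain ⟨C, hC, hhits⟩ := hx
  have hσ0 : ∀ᶠ k in l, 0 < σ k := hcσ.mono fun k hk => (hc0 _).trans_le hk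
  have hradius : Tendsto (fun k => tailRadius v β η (σ k)) l (𝓝 0) := by
    simpa only [tailRadius_zero v η hβ, Function.comp_def] using
      ((continuous_tailRadius v η hβ).tendsto 0).comp hσ
  have hsmall : Tendsto (fun k => C * (tailRadius v β η (σ k) * Real.log (1 + a / σ k))) l
      (𝓝 0) := by
    have := ((tendsto_rpow_mul_log_one_add_div (div_pos (sub_pos.2 hβ) (one_pos.trans hβ)) ha).comp
      (tendsto_nhdsWithin_iff.2 ⟨hσ, hσ0⟩)).const_mul ((v / η) ^ (1 / β))
    simpa only [tailRadius, mul_assoc, mul_zero, Function.comp_apply] using this.const_mul C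
  have hlog : Tendsto (fun k => C * (Real.log (n k) / n k * Real.log (1 + a) +
      |Real.log (n k) / n k * Real.log (c (n k))|)) l (𝓝 0) := by
    simpa using (((tendsto_log_div_natCast.mul_const (Real.log (1 + a))).add hc.abs).comp
      hn).const_mul C
  refine squeeze_zero' (hσ0.mono fun k hk => componentGain_nonneg ha hk.le _ _ _) ?_
    (by simpa only [add_zero] using hsmall.add hlog)
  filter_upwards [hcσ, hσ0, hn.eventually hhits, hn.eventually_ge_atTop 1,
    hradius.eventually_le_const one_half_pos] with k hck h0 hk hk1 hr
  exact componentGain_le ha hC (hc0 _) hck hk1 (hk (μ k) _ (tailRadius_pos hv hη h0) hr)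

lemma IsDegenerating.tendsto_componentGain (hμσ : IsDegenerating l μ σ) (hsparse : HasSparseHits x)
    (htight : HasTightHits x) (hn : Tendsto n l atTop) {c : ℕ → ℝ}
    (hc : Tendsto (fun n : ℕ => Real.log n / n * Real.log (c n)) atTop (𝓝 0))
    (hc0 : ∀ n, 0 < c n) (hcσ : ∀ᶠ k in l, c (n k) ≤ σ k) (hv : 0 < v) (hβ : 1 < β) (hη : 0 < η)
    (ha : 0 ≤ a) : Tendsto (fun k => componentGain v β η a x (n k) (μ k) (σ k)) l (𝓝 0) := by
  rcases hμσ with hσ | hσ | ⟨hμ, s, hs, hσ⟩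
  · exact tendsto_componentGain_of_scale_zero hsparse hn hc hc0 hcσ hv hβ hη ha hσ
  · exact tendsto_componentGain_of_scale_atTop ha hσ
  · exact tendsto_componentGain_of_loc_atTop htight hn hβ hμ ha hs hσ

end Limits

end Degenerating

/-! ### Comparison of likelihoods -/

section Likelihood

lemma log_le_log_add_sum_indicator {ι : Type*} {S : Finset ι} {f : ι → ℝ → ℝ} {μ σ : ι → ℝ}
    {b v β η τ p G y : ℝ} (hv : 0 < v) (hβ : 1 < β) (hη : 0 < η) (hτ : 0 < τ)
    (hS : S.card * η ≤ τ) (hb0 : 0 ≤ b) (hσ : ∀ m ∈ S, 0 < σ m) (hb : ∀ m x, f m x ≤ b)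
    (hf : ∀ m x, x ≠ 0 → f m x ≤ v * |x| ^ (-β)) (hp : 0 < p) (hG : 0 ≤ G)
    (hpG : p ≤ G + ∑ m ∈ S, locScale (f m) (μ m) (σ m) y) :
    Real.log p ≤ Real.log (G + τ) + ∑ m ∈ S,
      (Metric.closedBall (μ m) (tailRadius v β η (σ m))).indicator
        (fun _ => Real.log (1 + b / τ / σ m)) y := by
  set B : ι → ℝ := fun m =>
    (Metric.closedBall (μ m) (tailRadius v β η (σ m))).indicator (fun _ => b / σ m) y
  have hB : ∀ m ∈ S, 0 ≤ B m := fun m hm =>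
    Set.indicator_nonneg (fun _ _ => div_nonneg hb0 (hσ m hm).le) y
  have hle : p ≤ G + τ + ∑ m ∈ S, B m := calc
    p ≤ G + ∑ m ∈ S, (η + B m) := hpG.trans (by
        gcongr with m hm
        exact locScale_le_add_indicator hv hβ hη (hσ m hm) (hb m) (hf m) y)
    _ = G + S.card * η + ∑ m ∈ S, B m := by
        rw [Finset.sum_add_distrib, Finset.sum_const, nsmul_eq_mul, add_assoc]
    _ ≤ G + τ + ∑ m ∈ S, B m := by gcongr
  calc Real.log p ≤ Real.log (G + τ + ∑ m ∈ S, B m) := Real.log_le_log hp hle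
    _ ≤ Real.log (G + τ) + ∑ m ∈ S, Real.log (1 + B m / τ) :=
        log_add_sum_le S hτ (le_add_of_nonneg_left hG) hB
    _ = _ := by
        congr 1
        refine Finset.sum_congr rfl fun m _ => ?_
        by_cases hy : y ∈ Metric.closedBall (μ m) (tailRadius v β η (σ m))
        · simp only [B, Set.indicator_of_mem hy, div_right_comm b τ]
        · simp only [B, Set.indicator_of_notMem hy, zero_div, add_zero, Real.log_one]

lemma empiricalMean_log_le_add_sum_componentGain {ι : Type*} {S : Finset ι} {f : ι → ℝ → ℝ}
    {μ σ : ι → ℝ} {b v β η τ : ℝ} {p g : ℝ → ℝ} {x : ℕ → ℝ} {n : ℕ} (hv : 0 < v) (hβ : 1 < β)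
    (hη : 0 < η) (hτ : 0 < τ) (hS : S.card * η ≤ τ) (hb0 : 0 ≤ b) (hσ : ∀ m ∈ S, 0 < σ m)
    (hb : ∀ m x, f m x ≤ b) (hf : ∀ m x, x ≠ 0 → f m x ≤ v * |x| ^ (-β))
    (hp : ∀ i ∈ Finset.range n, 0 < p (x i)) (hg : ∀ y, 0 ≤ g y)
    (hpg : ∀ y, p y ≤ g y + ∑ m ∈ S, locScale (f m) (μ m) (σ m) y) :
    empiricalMean x (fun y => Real.log (p y)) n ≤
      empiricalMean x (fun y => Real.log (g y + τ)) n +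
        ∑ m ∈ S, componentGain v β η (b / τ) x n (μ m) (σ m) := by
  simp only [componentGain, ← empiricalMean_indicator_const]
  rw [← empiricalMean_sum, ← empiricalMean_add]
  exact empiricalMean_mono fun i hi =>
    log_le_log_add_sum_indicator hv hβ hη hτ hS hb0 hσ hb hf (hp i hi) (hg _) (hpg _)

variable {M : ℕ} {f : Fin M → ℝ → ℝ} {θ θ₀ : Param M} {x : ℕ → ℝ}

lemma mixture_pos_of_likelihood_pos (hf : ∀ m, IsDensity (f m)) (hθ : θ ∈ paramSpace M) {n : ℕ}
    (h : 0 < likelihood f x n θ) : ∀ i ∈ Finset.range n, 0 < mixture f θ (x i) := fun i hi =>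
  ((isDensity_mixture hf hθ).nonneg _).lt_of_ne' (Finset.prod_ne_zero_iff.1 h.ne' i hi)

lemma empiricalMean_log_mixture {n : ℕ} (h : ∀ i ∈ Finset.range n, 0 < mixture f θ (x i)) :
    empiricalMean x (fun y => Real.log (mixture f θ y)) n = Real.log (likelihood f x n θ) / n := by
  rw [likelihood, Real.log_prod fun i hi => (h i hi).ne', empiricalMean]

lemma le_of_eventually_likelihood_le (hf : ∀ m, IsDensity (f m)) {b v β : ℝ} (hb0 : 0 ≤ b)
    (hv : 0 < v) (hβ : 1 < β) (hb : ∀ m x, f m x ≤ b)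
    (htail : ∀ m x, x ≠ 0 → f m x ≤ v * |x| ^ (-β)) (hx : ∀ i, 0 < mixture f θ₀ (x i))
    {I₀ : ℝ} (h₀ : Tendsto (empiricalMean x fun y => Real.log (mixture f θ₀ y)) atTop (𝓝 I₀))
    {g : ℝ → ℝ} {τ I : ℝ} (hτ : 0 < τ) (hg : ∀ y, 0 ≤ g y)
    (hI : Tendsto (empiricalMean x fun y => Real.log (g y + τ)) atTop (𝓝 I))
    {ι : Type*} {l : Filter ι} [l.NeBot] {n : ι → ℕ} (hn : Tendsto n l atTop) {u : ι → Param M}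
    (hu : ∀ᶠ k in l, u k ∈ paramSpace M) {S : Finset (Fin M)}
    (hdom : ∀ᶠ k in l, ∀ y, mixture f (u k) y ≤
      g y + ∑ m ∈ S, locScale (f m) (loc (u k) m) (scale (u k) m) y)
    (hgain : ∀ m ∈ S, Tendsto (fun k => componentGain v β (τ / (M + 1)) (b / τ) x (n k)
      (loc (u k) m) (scale (u k) m)) l (𝓝 0))
    (hlik : ∀ᶠ k in l, likelihood f x (n k) θ₀ ≤ likelihood f x (n k) (u k)) : I₀ ≤ I := by
  have hlim := (hI.comp hn).add (tendsto_finsetSum S hgain)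
  rw [Finset.sum_const_zero, add_zero] at hlim
  refine le_of_tendsto_of_tendsto (h₀.comp hn) hlim ?_
  filter_upwards [hu, hdom, hlik] with k huk hdomk hlikk
  have hlik0 : 0 < likelihood f x (n k) θ₀ := Finset.prod_pos fun i _ => hx i
  have hpos := mixture_pos_of_likelihood_pos hf huk (hlik0.trans_le hlikk)
  have hcard : (S.card : ℝ) * (τ / (M + 1)) ≤ τ := by
    have hSM : (S.card : ℝ) ≤ M + 1 := by
      exact_mod_cast (Finset.card_le_univ S).trans ((Fintype.card_fin M).trans_le M.le_succ)
    rw [mul_div_left_comm]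
    exact mul_le_of_le_one_right hτ.le ((div_le_one (by positivity)).2 hSM)
  calc empiricalMean x (fun y => Real.log (mixture f θ₀ y)) (n k)
      ≤ empiricalMean x (fun y => Real.log (mixture f (u k) y)) (n k) := by
        rw [empiricalMean_log_mixture fun i _ => hx i, empiricalMean_log_mixture hpos]
        gcongr
    _ ≤ _ := empiricalMean_log_le_add_sum_componentGain hv hβ (by positivity) hτ hcard hb0
        (fun m _ => huk.2.2 m) hb htail hpos hg hdomk

end Likelihood

/-! ### Subsequential limits of parameters -/

section Limits

variable {M : ℕ} {f : Fin M → ℝ → ℝ} {θ θ₀ : Param M} {S : Finset (Fin M)} {N : ℝ}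

/-- The parameter vector with weights `α`, locations `μ` and scales `σ`. -/
noncomputable def mkParam (α μ σ : Fin M → ℝ) : Param M :=
  WithLp.toLp 2 fun i => ![α i.1, μ i.1, σ i.1] i.2

@[simp]
lemma weight_mkParam (α μ σ : Fin M → ℝ) : weight (mkParam α μ σ) = α := rfl

@[simp]
lemma loc_mkParam (α μ σ : Fin M → ℝ) : loc (mkParam α μ σ) = μ := rfl

@[simp]
lemma scale_mkParam (α μ σ : Fin M → ℝ) : scale (mkParam α μ σ) = σ := rfl

lemma mkParam_weight_loc_scale (θ : Param M) : mkParam (weight θ) (loc θ) (scale θ) = θ := by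
  ext ⟨m, c⟩
  fin_cases c <;> rfl

lemma tendsto_mkParam {ι : Type*} {l : Filter ι} {a b c : ι → Fin M → ℝ} {α μ σ : Fin M → ℝ}
    (ha : ∀ m, Tendsto (fun k => a k m) l (𝓝 (α m)))
    (hb : ∀ m, Tendsto (fun k => b k m) l (𝓝 (μ m)))
    (hc : ∀ m, Tendsto (fun k => c k m) l (𝓝 (σ m))) :
    Tendsto (fun k => mkParam (a k) (b k) (c k)) l (𝓝 (mkParam α μ σ)) := by
  refine ((PiLp.continuous_toLp 2 _).tendsto _).comp (tendsto_pi_nhds.2 fun ⟨m, i⟩ => ?_)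
  fin_cases i
  exacts [ha m, hb m, hc m]

/-- The parameter `θ` with location `0` and scale `N` in the components of `S`. -/
noncomputable def resetOn (S : Finset (Fin M)) (N : ℝ) (θ : Param M) : Param M :=
  mkParam (weight θ) (fun m => if m ∈ S then 0 else loc θ m)
    (fun m => if m ∈ S then N else scale θ m)

lemma resetOn_empty (N : ℝ) (θ : Param M) : resetOn ∅ N θ = θ := by
  simp only [resetOn, Finset.notMem_empty, if_false, mkParam_weight_loc_scale]

lemma resetOn_mem_paramSpace (S : Finset (Fin M)) (hN : 0 < N) (hθ : θ ∈ paramSpace M) :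
    resetOn S N θ ∈ paramSpace M := by
  refine ⟨hθ.1, hθ.2.1, fun m => ?_⟩
  simp only [resetOn, scale_mkParam]
  split_ifs
  exacts [hN, hθ.2.2 m]

lemma mixture_eq_subMixture_compl_add (f : Fin M → ℝ → ℝ) (S : Finset (Fin M)) (θ : Param M)
    (x : ℝ) : mixture f θ x = subMixture f Sᶜ θ x + subMixture f S θ x :=
  (Finset.sum_compl_add_sum S _).symm

lemma mixture_resetOn (f : Fin M → ℝ → ℝ) (S : Finset (Fin M)) (N : ℝ) (θ : Param M) (x : ℝ) :
    mixture f (resetOn S N θ) x =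
      subMixture f Sᶜ θ x + ∑ m ∈ S, weight θ m * locScale (f m) 0 N x := by
  rw [mixture_eq_subMixture_compl_add f S]
  congr 1
  · refine Finset.sum_congr rfl fun m hm => ?_
    simp only [resetOn, weight_mkParam, loc_mkParam, scale_mkParam,
      if_neg (Finset.mem_compl.1 hm)]
  · refine Finset.sum_congr rfl fun m hm => ?_
    simp only [resetOn, weight_mkParam, loc_mkParam, scale_mkParam, if_pos hm]

lemma mixture_le_resetOn_add (hf : ∀ m, IsDensity (f m)) (hθ : θ ∈ paramSpace M)
    (S : Finset (Fin M)) (hN : 0 < N) (x : ℝ) :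
    mixture f θ x ≤ mixture f (resetOn S N θ) x +
      ∑ m ∈ S, locScale (f m) (loc θ m) (scale θ m) x := by
  have hreset : 0 ≤ ∑ m ∈ S, weight θ m * locScale (f m) 0 N x :=
    Finset.sum_nonneg fun m _ => mul_nonneg (hθ.2.1 m) (((hf m).locScale 0 hN).nonneg x)
  have hsub : subMixture f S θ x ≤ ∑ m ∈ S, locScale (f m) (loc θ m) (scale θ m) x :=
    Finset.sum_le_sum fun m _ => mul_le_of_le_one_left
      (((hf m).locScale _ (hθ.2.2 m)).nonneg x) (weight_le_one hθ m)
  rw [mixture_resetOn, mixture_eq_subMixture_compl_add f S]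
  linarith

lemma tendsto_mixture_resetOn {v : ℝ} (hf : ∀ m, IsDensity (f m)) (hv : ∀ m x, f m x ≤ v)
    (S : Finset (Fin M)) (θ : Param M) (x : ℝ) :
    Tendsto (fun N => mixture f (resetOn S N θ) x) atTop (𝓝 (subMixture f Sᶜ θ x)) := by
  have hlocScale : ∀ m, Tendsto (fun N => locScale (f m) 0 N x) atTop (𝓝 0) := by
    intro m
    refine squeeze_zero' ?_ ?_ (tendsto_id.const_div_atTop v)
    all_goals filter_upwards [eventually_gt_atTop 0] with N hN
    · exact ((hf m).locScale 0 hN).nonneg x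
    · exact locScale_le hN.le (hv m) x
  simp only [mixture_resetOn]
  simpa using (tendsto_finsetSum S fun m _ => (hlocScale m).const_mul (weight θ m)).const_add
    (subMixture f Sᶜ θ x)

lemma eq_empty_of_forall_mixture_resetOn_ae_eq {v : ℝ} (hf : ∀ m, IsDensity (f m))
    (hv : ∀ m x, f m x ≤ v) (hθ : θ ∈ paramSpace M)
    (hM : mixture f θ₀ ∉ mixtureClass f (M - 1))
    (h : ∀ N > 0, mixture f (resetOn S N θ) =ᵐ[volume] mixture f θ₀) : S = ∅ := by
  by_contra hS
  refine hM ⟨Sᶜ, ?_, θ, hθ, ?_⟩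
  · rw [Finset.card_compl, Fintype.card_fin]
    exact Nat.sub_le_sub_left (Finset.card_pos.2 (Finset.nonempty_iff_ne_empty.2 hS)) M
  have hall : ∀ᵐ x, ∀ k : ℕ, mixture f (resetOn S (k + 1) θ) x = mixture f θ₀ x :=
    ae_all_iff.2 fun k => h (k + 1) k.cast_add_one_pos
  filter_upwards [hall] with x hx
  refine tendsto_nhds_unique ?_ ((tendsto_mixture_resetOn hf hv S θ x).comp
    (tendsto_atTop_add_const_right _ 1 tendsto_natCast_atTop_atTop))
  simpa only [Function.comp_def, hx] using tendsto_const_nhds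

/-- Convergence of the parameters `u` to `θ` in the compactification: the components of `S`
degenerate, and only their weights converge to those of `θ`. -/
structure DegeneratesOn {ι : Type*} (l : Filter ι) (S : Finset (Fin M)) (u : ι → Param M)
    (θ : Param M) : Prop where
  tendsto_weight : ∀ m, Tendsto (fun k => weight (u k) m) l (𝓝 (weight θ m))
  tendsto_loc : ∀ m ∉ S, Tendsto (fun k => loc (u k) m) l (𝓝 (loc θ m))
  tendsto_scale : ∀ m ∉ S, Tendsto (fun k => scale (u k) m) l (𝓝 (scale θ m))
  isDegenerating : ∀ m ∈ S, IsDegenerating l (fun k => loc (u k) m) fun k => scale (u k) m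

lemma DegeneratesOn.tendsto_resetOn {ι : Type*} {l : Filter ι} {u : ι → Param M}
    (h : DegeneratesOn l S u θ) (N : ℝ) :
    Tendsto (fun k => resetOn S N (u k)) l (𝓝 (resetOn S N θ)) := by
  refine tendsto_mkParam h.tendsto_weight (fun m => ?_) fun m => ?_
  all_goals split_ifs with hm
  exacts [tendsto_const_nhds, h.tendsto_loc m hm, tendsto_const_nhds, h.tendsto_scale m hm]

lemma isDegenerating_or_tendsto {ι : Type*} {l : Filter ι} [l.NeBot] {μ σ : ι → ℝ}
    (hσ0 : ∀ᶠ k in l, 0 ≤ σ k) {a b : EReal} (hμ : Tendsto (fun k => (μ k : EReal)) l (𝓝 a))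
    (hσ : Tendsto (fun k => (σ k : EReal)) l (𝓝 b)) :
    IsDegenerating l μ σ ∨ ∃ m s, 0 < s ∧ Tendsto μ l (𝓝 m) ∧ Tendsto σ l (𝓝 s) := by
  have hb : 0 ≤ b := ge_of_tendsto hσ (hσ0.mono fun k hk => EReal.coe_nonneg.2 hk)
  induction b with
  | bot => exact absurd hb (by simp)
  | top => exact .inl (.inr (.inl (EReal.tendsto_coe_nhds_top_iff.1 hσ)))
  | coe s =>
    have hσs : Tendsto σ l (𝓝 s) := EReal.tendsto_coe.1 hσ
    rcases (EReal.coe_nonneg.1 hb).eq_or_lt with rfl | hs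
    · exact .inl (.inl hσs)
    induction a with
    | bot =>
      exact .inl (.inr (.inr
        ⟨tendsto_abs_atBot_atTop.comp (EReal.tendsto_coe_nhds_bot_iff.1 hμ), s, hs, hσs⟩))
    | top =>
      exact .inl (.inr (.inr
        ⟨tendsto_abs_atTop_atTop.comp (EReal.tendsto_coe_nhds_top_iff.1 hμ), s, hs, hσs⟩))
    | coe m => exact .inr ⟨m, s, hs, EReal.tendsto_coe.1 hμ, hσs⟩

theorem exists_degeneratesOn {u : ℕ → Param M} (hu : ∀ᶠ k in atTop, u k ∈ paramSpace M) :
    ∃ φ : ℕ → ℕ, StrictMono φ ∧ ∃ S, ∃ θ ∈ paramSpace M, DegeneratesOn atTop S (u ∘ φ) θ := by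
  classical
  let w : ℕ → (Fin M → ℝ) × (Fin M → EReal × EReal) := fun k =>
    (weight (u k), fun m => (loc (u k) m, scale (u k) m))
  obtain ⟨⟨α, p⟩, hα, φ, hφ, hlim⟩ := ((isCompact_stdSimplex ℝ (Fin M)).prod
    isCompact_univ).tendsto_subseq' (x := w)
    (hu.mono fun k hk => ⟨⟨hk.2.1, hk.1⟩, Set.mem_univ _⟩).frequently
  have hweight : ∀ m, Tendsto (fun k => weight (u (φ k)) m) atTop (𝓝 (α m)) :=
    tendsto_pi_nhds.1 ((continuous_fst.tendsto _).comp hlim)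
  have hcomp : ∀ m, Tendsto (fun k => ((loc (u (φ k)) m, scale (u (φ k)) m) : EReal × EReal))
      atTop (𝓝 (p m)) := tendsto_pi_nhds.1 ((continuous_snd.tendsto _).comp hlim)
  have hdich : ∀ m, ∃ μ s : ℝ, 0 < s ∧
      (¬ IsDegenerating atTop (fun k => loc (u (φ k)) m) (fun k => scale (u (φ k)) m) →
        Tendsto (fun k => loc (u (φ k)) m) atTop (𝓝 μ) ∧
        Tendsto (fun k => scale (u (φ k)) m) atTop (𝓝 s)) := by
    intro m
    rcases isDegenerating_or_tendsto
      (hφ.tendsto_atTop.eventually (hu.mono fun k hk => (hk.2.2 m).le))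
      ((continuous_fst.tendsto _).comp (hcomp m)) ((continuous_snd.tendsto _).comp (hcomp m))
      with h | ⟨μ, s, hs, hμs⟩
    · exact ⟨0, 1, one_pos, fun hnot => absurd h hnot⟩
    · exact ⟨μ, s, hs, fun _ => hμs⟩
  choose μ s hs hμs using hdich
  refine ⟨φ, hφ, Finset.univ.filter fun m =>
    IsDegenerating atTop (fun k => loc (u (φ k)) m) fun k => scale (u (φ k)) m,
    mkParam α μ s, ⟨hα.1.2, hα.1.1, hs⟩, ⟨hweight, fun m hm => ?_, fun m hm => ?_, fun m hm => ?_⟩⟩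
  · exact (hμs m (by simpa using hm)).1
  · exact (hμs m (by simpa using hm)).2
  · exact (Finset.mem_filter.1 hm).2

end Limits

/-! ### Consistency along typical observations -/

section Consistency

variable {M : ℕ} {f : Fin M → ℝ → ℝ} {θ θ₀ : Param M}

/-- As in Wald's consistency proof: the mixtures with parameters near `θ` have an envelope whose
mean log-likelihood along `x` is asymptotically smaller than that of `f(·; θ₀)`. The number `τ`
leaves room for the contribution of degenerating components. -/
def HasWaldEnvelope (f : Fin M → ℝ → ℝ) (θ₀ : Param M) (x : ℕ → ℝ) (θ : Param M) : Prop :=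
  ∃ g : ℝ → ℝ, ∃ τ > 0, ∃ I < ∫ y, Real.log (mixture f θ₀ y) ∂densityLaw (mixture f θ₀),
    (∀ y, 0 ≤ g y) ∧ (∀ᶠ θ' in 𝓝[paramSpace M] θ, ∀ y, mixture f θ' y ≤ g y) ∧
      Tendsto (empiricalMean x fun y => Real.log (g y + τ)) atTop (𝓝 I)

/-- The almost sure properties of a sample `x` from `f(·; θ₀)` from which consistency follows
deterministically. -/
structure IsTypical (f : Fin M → ℝ → ℝ) (θ₀ : Param M) (x : ℕ → ℝ) : Prop where
  pos : ∀ i, 0 < mixture f θ₀ (x i)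
  log_true : Tendsto (empiricalMean x fun y => Real.log (mixture f θ₀ y)) atTop
    (𝓝 (∫ y, Real.log (mixture f θ₀ y) ∂densityLaw (mixture f θ₀)))
  envelope : ∀ θ ∈ paramSpace M, ¬ mixture f θ =ᵐ[volume] mixture f θ₀ →
    HasWaldEnvelope f θ₀ x θ
  tight : HasTightHits x
  sparse : HasSparseHits x

section Sample

variable {Ω : Type*} [MeasurableSpace Ω] {P : Measure Ω} {X : ℕ → Ω → ℝ}

lemma ae_hasWaldEnvelope (hf : ∀ m, IsDensity (f m)) (hθ₀ : θ₀ ∈ paramSpace M) {v : ℝ}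
    (hv : ∀ m x, f m x ≤ v) (hv0 : 0 ≤ v) (h2 : SupMeasurable f) (h3 : ParamContinuous f)
    (h4 : LogIntegrable f θ₀) (hindep : iIndepFun X P)
    (hlaw : ∀ i, HasLaw (X i) (densityLaw (mixture f θ₀)) P) :
    ∀ᵐ ω ∂P, ∀ θ ∈ paramSpace M, ¬ mixture f θ =ᵐ[volume] mixture f θ₀ →
      HasWaldEnvelope f θ₀ (fun i => X i ω) θ := by
  set D : Set (Param M) := {θ | θ ∈ paramSpace M ∧ ¬ mixture f θ =ᵐ[volume] mixture f θ₀}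
  choose! ρ hρ0 hdom hint hlt using fun θ (hθ : θ ∈ D) =>
    (eventually_mem_nhdsWithin.and
      (eventually_integral_log_ballSup_lt hf hθ₀ hv hv0 h2 h3 h4 hθ.1 hθ.2)).exists
  obtain ⟨T, hTD, hT, hcover⟩ := TopologicalSpace.countable_cover_nhdsWithin (s := D)
    (f := fun θ => Metric.ball θ (ρ θ))
    fun θ hθ => mem_nhdsWithin_of_mem_nhds (Metric.ball_mem_nhds θ (hρ0 θ hθ))
  filter_upwards [(ae_ball_iff hT).2 fun t ht =>
    ae_tendsto_empiricalMean hindep hlaw (hint t (hTD ht))] with ω hω θ hθ hne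
  obtain ⟨t, ht, hθt⟩ := Set.mem_iUnion₂.1 (hcover (show θ ∈ D from ⟨hθ, hne⟩))
  refine ⟨ballSup f t (ρ t), ρ t, hρ0 t (hTD ht), _, hlt t (hTD ht), ballSup_nonneg hf t _, ?_,
    hω t ht⟩
  filter_upwards [self_mem_nhdsWithin,
    mem_nhdsWithin_of_mem_nhds (Metric.isOpen_ball.mem_nhds hθt)] with θ' hθ' hball
  exact hdom t (hTD ht) θ' hθ' hball.le

theorem ae_isTypical (hf : ∀ m, IsDensity (f m)) (hθ₀ : θ₀ ∈ paramSpace M) {v : ℝ}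
    (hv : ∀ m x, f m x ≤ v) (hv0 : 0 ≤ v) (h2 : SupMeasurable f) (h3 : ParamContinuous f)
    (h4 : LogIntegrable f θ₀) (hindep : iIndepFun X P)
    (hlaw : ∀ i, HasLaw (X i) (densityLaw (mixture f θ₀)) P) :
    ∀ᵐ ω ∂P, IsTypical f θ₀ fun i => X i ω := by
  have hp := isDensity_mixture hf hθ₀
  have := hp.isProbabilityMeasure_densityLaw
  have hlog := hp.integrable_densityLaw (Real.measurable_log.comp_aemeasurable hp.aemeasurable) h4
  obtain ⟨s, hs, hθs⟩ := exists_pos_le_scale hθ₀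
  filter_upwards [ae_forall_of_hasLaw hlaw hp.ae_pos, ae_tendsto_empiricalMean hindep hlaw hlog,
    ae_hasWaldEnvelope hf hθ₀ hv hv0 h2 h3 h4 hindep hlaw, ae_hasTightHits hindep hlaw,
    ae_hasSparseHits hindep hlaw (div_nonneg hv0 hs.le)
      (densityLaw_le_smul (mixture_le hv hv0 hs hθ₀ hθs))] with ω hpos hmean henv htight hsparse
  exact ⟨hpos, hmean, henv, htight, hsparse⟩

end Sample

variable {x : ℕ → ℝ} {c : ℕ → ℝ}

lemma IsTypical.mixture_resetOn_ae_eq (hx : IsTypical f θ₀ x) (hf : ∀ m, IsDensity (f m))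
    (h1 : TailBound f) (hc0 : ∀ n, 0 < c n)
    (hc : Tendsto (fun n : ℕ => Real.log n / n * Real.log (c n)) atTop (𝓝 0))
    {ι : Type*} {l : Filter ι} [l.NeBot] {n : ι → ℕ} (hn : Tendsto n l atTop) {u : ι → Param M}
    (hu : ∀ᶠ k in l, u k ∈ paramSpace M) (hcu : ∀ᶠ k in l, ∀ m, c (n k) ≤ scale (u k) m)
    (hlik : ∀ᶠ k in l, likelihood f x (n k) θ₀ ≤ likelihood f x (n k) (u k))
    {S : Finset (Fin M)} (hθ : θ ∈ paramSpace M) (hdeg : DegeneratesOn l S u θ) {N : ℝ}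
    (hN : 0 < N) : mixture f (resetOn S N θ) =ᵐ[volume] mixture f θ₀ := by
  obtain ⟨v₀, v₁, β, hv₀, hv₁, hβ, hv⟩ := h1
  by_contra hne
  obtain ⟨g, τ, hτ, I, hI, hg, hdom, hmean⟩ :=
    hx.envelope _ (resetOn_mem_paramSpace S hN hθ) hne
  have hreset : Tendsto (fun k => resetOn S N (u k)) l (𝓝[paramSpace M] resetOn S N θ) :=
    tendsto_nhdsWithin_iff.2
      ⟨hdeg.tendsto_resetOn N, hu.mono fun k hk => resetOn_mem_paramSpace S hN hk⟩
  refine hI.not_ge (le_of_eventually_likelihood_le (S := S) hf hv₀.le hv₁ hβ (fun m y => (hv m y).1)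
    (fun m y => (hv m y).2) hx.pos hx.log_true hτ hg hmean hn hu ?_ (fun m hm => ?_) hlik)
  · filter_upwards [hu, hreset.eventually hdom] with k hk hgk y
    exact (mixture_le_resetOn_add hf hk S hN y).trans (by gcongr; exact hgk y)
  · exact (hdeg.isDegenerating m hm).tendsto_componentGain hx.sparse hx.tight hn hc hc0
      (hcu.mono fun k hk => hk m) hv₁ hβ (by positivity) (by positivity)

theorem IsTypical.tendsto_setDist (hx : IsTypical f θ₀ x) (hf : ∀ m, IsDensity (f m))
    (h1 : TailBound f) (hM : mixture f θ₀ ∉ mixtureClass f (M - 1)) (hc0 : ∀ n, 0 < c n)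
    (hc : Tendsto (fun n : ℕ => Real.log n / n * Real.log (c n)) atTop (𝓝 0)) {θhat : ℕ → Param M}
    (hθhat : ∀ᶠ n in atTop, θhat n ∈ paramSpace M ∧ (∀ m, c n ≤ scale (θhat n) m) ∧
      likelihood f x n θ₀ ≤ likelihood f x n (θhat n)) :
    Tendsto (fun n => setDist (equivParams f (θhat n)) (equivParams f θ₀)) atTop (𝓝 0) := by
  refine tendsto_of_subseq_tendsto fun ns hns => ?_
  obtain ⟨φ, hφ, S, θ, hθ, hdeg⟩ :=
    exists_degeneratesOn (u := θhat ∘ ns) (hns.eventually (hθhat.mono fun n hn => hn.1))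
  have hlim : Tendsto (ns ∘ φ) atTop atTop := hns.comp hφ.tendsto_atTop
  have hev := hlim.eventually hθhat
  have hreset : ∀ N > 0, mixture f (resetOn S N θ) =ᵐ[volume] mixture f θ₀ := fun N hN =>
    hx.mixture_resetOn_ae_eq hf h1 hc0 hc hlim (hev.mono fun k hk => hk.1)
      (hev.mono fun k hk => hk.2.1) (hev.mono fun k hk => hk.2.2) hθ hdeg hN
  obtain rfl : S = ∅ := by
    obtain ⟨v₀, _, _, _, _, _, hv⟩ := h1
    exact eq_empty_of_forall_mixture_resetOn_ae_eq hf (fun m y => (hv m y).1) hθ hM hreset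
  have hconv : Tendsto (θhat ∘ ns ∘ φ) atTop (𝓝 θ) := by
    simpa only [resetOn_empty, Function.comp_assoc] using hdeg.tendsto_resetOn 1
  have heq : θ ∈ equivParams f θ₀ := ⟨hθ, by simpa only [resetOn_empty] using hreset 1 one_pos⟩
  refine ⟨φ, tendsto_of_tendsto_of_tendsto_of_le_of_le' tendsto_const_nhds
    (tendsto_iff_edist_tendsto_0.1 hconv) (.of_forall fun _ => zero_le) ?_⟩
  filter_upwards [hev] with k hk
  exact iInf₂_le_of_le _ ⟨hk.1, .rfl⟩ (iInf₂_le θ heq)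

lemma eventually_mem_restrictedSpace (hθ : θ ∈ paramSpace M) (c₀ : ℝ) {d : ℝ} (hd : 0 < d) :
    ∀ᶠ n : ℕ in atTop, θ ∈ restrictedSpace M c₀ d n := by
  have hlim : Tendsto (fun n : ℕ => c₀ * Real.exp (-((n : ℝ) ^ d))) atTop (𝓝 0) := by
    simpa only [mul_zero, Function.comp_def] using (Real.tendsto_exp_neg_atTop_nhds_zero.comp
      ((tendsto_rpow_atTop hd).comp tendsto_natCast_atTop_atTop)).const_mul c₀
  exact (eventually_all.2 fun m => hlim.eventually_le_const (hθ.2.2 m)).mono fun n hn => ⟨hθ, hn⟩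

end Consistency

end LocScaleMixture

theorem theorem2_general {M : ℕ} (f : Fin M → ℝ → ℝ)
    (hdens : ∀ m, LocScaleMixture.IsDensity (f m))
    (θ₀ : LocScaleMixture.Param M) (hθ₀ : θ₀ ∈ LocScaleMixture.paramSpace M)
    (h1 : LocScaleMixture.TailBound f)
    (h2 : LocScaleMixture.SupMeasurable f)
    (h3 : LocScaleMixture.ParamContinuous f)
    (h4 : LocScaleMixture.LogIntegrable f θ₀)
    (hM : LocScaleMixture.mixture f θ₀ ∉ LocScaleMixture.mixtureClass f (M - 1))
    (c : ℕ → ℝ) (hc0 : ∀ n, 0 < c n)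
    (hc : Tendsto (fun n : ℕ => Real.log n / n * Real.log (c n)) atTop (𝓝 0))
    {Ω : Type*} [MeasurableSpace Ω] (P : Measure Ω)
    (X : ℕ → Ω → ℝ) (hindep : iIndepFun X P)
    (hlaw : ∀ i, HasLaw (X i) (LocScaleMixture.mixtureLaw f θ₀) P)
    (θhat : ℕ → Ω → LocScaleMixture.Param M) :
    ∀ᵐ ω ∂P,
      (∀ᶠ n in atTop, θhat n ω ∈ LocScaleMixture.paramSpace M ∧
        (∀ m, c n ≤ LocScaleMixture.scale (θhat n ω) m) ∧
        LocScaleMixture.likelihood f (fun i => X i ω) n θ₀ ≤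
          LocScaleMixture.likelihood f (fun i => X i ω) n (θhat n ω)) →
      Tendsto (fun n => LocScaleMixture.setDist
        (LocScaleMixture.equivParams f (θhat n ω)) (LocScaleMixture.equivParams f θ₀))
        atTop (𝓝 0) := by
  obtain ⟨v₀, _, _, hv₀, _, _, hv⟩ := id h1
  filter_upwards [LocScaleMixture.ae_isTypical hdens hθ₀ (fun m y => (hv m y).1) hv₀.le h2 h3 h4
    hindep hlaw] with ω hω hθhat
  exact hω.tendsto_setDist hdens h1 hM hc0 hc hθhat

theorem theorem2 {M : ℕ} (f : Fin M → ℝ → ℝ)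
    (hdens : ∀ m, LocScaleMixture.IsDensity (f m))
    (θ₀ : LocScaleMixture.Param M) (hθ₀ : θ₀ ∈ LocScaleMixture.paramSpace M)
    (h1 : LocScaleMixture.TailBound f)
    (h2 : LocScaleMixture.SupMeasurable f)
    (h3 : LocScaleMixture.ParamContinuous f)
    (h4 : LocScaleMixture.LogIntegrable f θ₀)
    (hM : LocScaleMixture.mixture f θ₀ ∈
      LocScaleMixture.mixtureClass f M \ LocScaleMixture.mixtureClass f (M - 1))
    (c₀ d : ℝ) (hc₀ : 0 < c₀) (hd0 : 0 < d) (hd1 : d < 1)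
    {Ω : Type*} [MeasurableSpace Ω] (P : Measure Ω) [IsProbabilityMeasure P]
    (X : ℕ → Ω → ℝ) (hindep : iIndepFun X P)
    (hlaw : ∀ i, HasLaw (X i) (LocScaleMixture.mixtureLaw f θ₀) P)
    (θhat : ℕ → Ω → LocScaleMixture.Param M) :
    ∀ᵐ ω ∂P,
      (∀ᶠ n in atTop, LocScaleMixture.IsMLE f (LocScaleMixture.restrictedSpace M c₀ d n)
        (fun i => X i ω) n (θhat n ω)) →
      Tendsto (fun n => LocScaleMixture.setDist
        (LocScaleMixture.equivParams f (θhat n ω)) (LocScaleMixture.equivParams f θ₀))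
        atTop (𝓝 0) := by
  have hconsistent := theorem2_general f hdens θ₀ hθ₀ h1 h2 h3 h4 hM.2 _ (fun n => by positivity)
    (LocScaleMixture.tendsto_log_div_mul_log_const_mul_exp_neg_rpow hc₀ hd1) P X hindep hlaw θhat
  filter_upwards [hconsistent] with ω hω hmle
  refine hω ?_
  filter_upwards [hmle, LocScaleMixture.eventually_mem_restrictedSpace hθ₀ c₀ hd0] with n hn hθ₀n
  exact ⟨hn.1.1, hn.1.2, hn.2 θ₀ hθ₀n⟩
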